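/- **Theorem 1.** For $\alpha>0$ and a real $m\times m$ correlation matrix $C$ (symmetric, positive semidefinite, unit diagonal), let $\Gamma_m(\alpha,C)$ denote the probability law on $[0,\infty)^m$ with Laplace transform $$\int e^{-(t_1x_1+\dots+t_mx_m)}\,d\Gamma_m(\alpha,C)(x)=|I_m+CT|^{-\alpha},\qquad T=\operatorname{diag}(t_1,\dots,t_m),\ t_1,\dots,t_m\ge 0,$$ and, when this law exists, let $F(x_1,\dots,x_m;\alpha,C)$ be its joint cumulative distribution function. Let $$R=\begin{pmatrix}R_{11}&R_{12}\\R_{21}&R_{22}\end{pmatrix}$$ be a non-singular $n\times n$ correlation matrix, $n=n_1+n_2$, with $n_i\times n_i$ blocks $R_{ii}$ and with $R_{12}$ of positive rank, and let $2\alpha$ be a positive integer or a real number $>n-2$. Then the laws $\Gamma_n(\alpha,R)$, $\Gamma_{n_1}(\alpha,R_{11})$ and $\Gamma_{n_2}(\alpha,R_{22})$ exist and are uniquely determined by their Laplace transforms, and $$F(x_1,\dots,x_n;\alpha,R)>F(x_1,\dots,x_{n_1};\alpha,R_{11})\,F(x_{n_1+1},\dots,x_n;\alpha,R_{22})$$ for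 all $x_1,\dots,x_n>0$. -/

import Mathlib

open MeasureTheory

/-- A real correlation matrix: symmetric positive semidefinite with unit diagonal. -/
structure IsCorrelationMatrix {ι : Type*} [Fintype ι] (R : Matrix ι ι ℝ) : Prop where
  posSemidef : R.PosSemidef
  diag_eq_one : ∀ i, R i i = 1

/-- `μ` is the multivariate gamma law `Γ_n(α, R)`: the probability measure on the nonnegative
orthant with Laplace transform `|I + R T|^(-α)`, where `T = diag(t₁, …, tₙ)` and `tᵢ ≥ 0`. -/
structure IsMultivariateGamma {ι : Type*} [Fintype ι] [DecidableEq ι]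
    (α : ℝ) (R : Matrix ι ι ℝ) (μ : Measure (ι → ℝ)) : Prop where
  isProbabilityMeasure : IsProbabilityMeasure μ
  nonneg : ∀ᵐ x ∂μ, ∀ i, 0 ≤ x i
  laplace : ∀ t : ι → ℝ, (∀ i, 0 ≤ t i) →
    ∫ x, Real.exp (-∑ i, t i * x i) ∂μ = (1 + R * Matrix.diagonal t).det ^ (-α)

/-- The joint cumulative distribution function `x ↦ μ {y | ∀ i, y i ≤ x i}`. -/
noncomputable def jointCDF {ι : Type*} (μ : Measure (ι → ℝ)) (x : ι → ℝ) : ℝ :=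
  μ.real {y | ∀ i, y i ≤ x i}

/-!
Write `R_τ` for the matrix `R` with its off-diagonal blocks multiplied by `τ`, so that `R₁ = R` and
`Γ(α, R₀)` is the product of `Γ(α, R₁₁)` and `Γ(α, R₂₂)`. The argument follows Royen: the
distribution function of `Γ(α, R_τ)` increases with `τ ∈ [0, 1]`.

The expansion of `|I + R_τ T|` into principal minors (`det_one_add_mul_diagonal`) shows that the
`τ`-derivative of `|I + R_τ T| ^ (-α)` is `-α |I + R_τ T| ^ (-(α + 1))` times the sum over `S` of
the `τ`-derivatives of the minors `|R_τ,S|`, each multiplied by `∏_S tᵢ`. The minors decrease in `τ`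
(`antitoneOn_det_crossScale`), the power is the Laplace transform of `Γ(α + 1, R_τ)`, and on a test
function the factor `tᵢ` acts as `-∂/∂yᵢ`. So the integral under `Γ(α, R_τ)` of any product of
nonnegative decreasing functions of the coordinates grows with `τ`. Differentiation of densities is
avoided by testing against products of polynomials in `exp (-yᵢ)`, for which all integrals are
finite linear combinations of values of the Laplace transform (`hasDerivAt_integral_testFun`). The
increasing polynomials `stepPolynomial` converge to the indicator function of
`exp (-xᵢ) ≤ exp (-yᵢ)`, and the limit of the inequality is the inequality of distribution functions.

Strictness comes from a pair `S = {i, j}` with `R i j ≠ 0` across the blocks, whose minor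
`1 - τ² (R i j)²` decreases strictly, together with a lower bound of `Γ(α + 1, R_τ)` by a fixed positive
multiple of a product of gamma laws, uniform in `τ` (`exists_isMultivariateGamma_ge`).

Both that bound and existence rest on one construction. If `R = c I + A` with `c > 0` and `Γ(α, A)`
exists, then `Γ(α, R)` is a Poisson mixture of products of gamma laws
(`exists_isMultivariateGamma_smul_one_add`). For a Gram matrix `A = BᵀB` with `m` rows, `Γ(α, A)` is
the law of the quadratic forms `bᵢᵀ W bᵢ` of a Wishart matrix `W` of size `m`, where `bᵢ` is the
`i`-th column of `B`; the triangular factor of `W` is built column by column as in the Bartlett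
decomposition. This works for `2α` a natural number or `2α > m - 1`
(`exists_isMultivariateGamma_gram`). Taking `c` to be the smallest eigenvalue of `R` makes
`m = n - 1`, whence the condition `2α > n - 2`.

Uniqueness is the Stone–Weierstrass theorem for the algebra generated by the functions `exp (-yᵢ)`.
-/

namespace MultivariateGamma

open Matrix ProbabilityTheory
open scoped ENNReal NNReal

variable {ι ι₁ ι₂ : Type*} [Fintype ι] [DecidableEq ι] [Fintype ι₁] [DecidableEq ι₁]
  [Fintype ι₂] [DecidableEq ι₂]

/-! ### Determinants and principal minors -/

/-- Every positive semidefinite real matrix is a Gram matrix `Cᵀ C` of square shape. -/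
lemma exists_eq_transpose_mul_self {A : Matrix ι ι ℝ} (hA : A.PosSemidef) :
    ∃ C : Matrix ι ι ℝ, A = Cᵀ * C := by
  open scoped MatrixOrder in
  obtain ⟨C, hC⟩ := CStarAlgebra.nonneg_iff_eq_star_mul_self.mp hA.nonneg
  exact ⟨C, by simpa [star_eq_conjTranspose, conjTranspose_eq_transpose_of_trivial] using hC⟩

omit [DecidableEq ι] in
lemma posSemidef_transpose_mul_self {κ : Type*} [Fintype κ] (B : Matrix κ ι ℝ) :
    (Bᵀ * B).PosSemidef := by
  simpa [conjTranspose_eq_transpose_of_trivial] using posSemidef_conjTranspose_mul_self B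

lemma posSemidef_gram_diagonal {κ : Type*} [Fintype κ] (B : Matrix κ ι ℝ) {t : ι → ℝ}
    (ht : ∀ i, 0 ≤ t i) : (B * diagonal t * Bᵀ).PosSemidef := by
  simpa [conjTranspose_eq_transpose_of_trivial] using
    (PosSemidef.diagonal (d := t) (fun i => ht i)).mul_mul_conjTranspose_same B

lemma det_one_add_mul_diagonal_pos {A : Matrix ι ι ℝ} (hA : A.PosSemidef) {t : ι → ℝ}
    (ht : ∀ i, 0 ≤ t i) : 0 < (1 + A * diagonal t).det := by
  obtain ⟨C, rfl⟩ := exists_eq_transpose_mul_self hA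
  rw [Matrix.mul_assoc, det_one_add_mul_comm]
  exact (PosDef.one.add_posSemidef (posSemidef_gram_diagonal C ht)).det_pos

/-- Splitting off the smallest eigenvalue `c` of a positive definite matrix leaves a Gram matrix
of vectors in one dimension less. -/
lemma exists_eq_smul_one_add_gram {n : ℕ} (hn : Fintype.card ι = n + 1) {R : Matrix ι ι ℝ}
    (hR : R.PosDef) : ∃ c : ℝ, 0 < c ∧ ∃ B : Matrix (Fin n) ι ℝ, R = c • 1 + Bᵀ * B := by
  have : Nonempty ι := Fintype.card_pos_iff.mp (by omega)
  set e := hR.1.eigenvalues with he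
  obtain ⟨j₀, hj₀⟩ := Finite.exists_min e
  let U : Matrix ι ι ℝ := hR.1.eigenvectorUnitary
  have hU : U * Uᵀ = 1 := by
    have := Unitary.mul_star_self_of_mem hR.1.eigenvectorUnitary.2
    simpa only [star_eq_conjTranspose, conjTranspose_eq_transpose_of_trivial] using this
  have hspec : R = U * diagonal e * Uᵀ := by
    have := hR.1.spectral_theorem
    simpa [U, Unitary.conjStarAlgAut_apply, star_eq_conjTranspose,
      conjTranspose_eq_transpose_of_trivial, Function.comp_def] using this
  have hcard : Fintype.card {j // j ≠ j₀} = n := by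
    simp [Fintype.card_subtype_compl, hn]
  let f : Fin n ≃ {j // j ≠ j₀} := (Fintype.equivFinOfCardEq hcard).symm
  refine ⟨e j₀, hR.eigenvalues_pos j₀,
    of fun k i => Real.sqrt (e (f k) - e j₀) * U i (f k), ?_⟩
  have h1 : R = e j₀ • 1 + U * diagonal (fun j => e j - e j₀) * Uᵀ := by
    have : diagonal (fun j => e j - e j₀) = diagonal e - e j₀ • 1 := by
      rw [smul_one_eq_diagonal, diagonal_sub]
    rw [this, Matrix.mul_sub, Matrix.sub_mul, ← hspec, mul_smul_comm, Matrix.mul_one,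
      smul_mul_assoc, hU]
    abel
  rw [h1]
  congr 1
  ext i k
  rw [mul_apply, mul_apply]
  simp only [mul_diagonal, transpose_apply, of_apply]
  rw [← f.symm.sum_comp]
  simp only [Equiv.apply_symm_apply]
  rw [← Fintype.sum_subtype_add_sum_subtype (fun j => j ≠ j₀)
    (fun j => U i j * (e j - e j₀) * U k j)]
  have : ∑ x : {j // ¬j ≠ j₀}, U i x * (e x - e j₀) * U k x = 0 := by
    apply Finset.sum_eq_zero
    rintro ⟨x, hx⟩ -
    have : x = j₀ := by simpa using hx
    simp [this]
  rw [this, add_zero]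
  refine Finset.sum_congr rfl fun j _ => ?_
  have := Real.mul_self_sqrt (sub_nonneg.mpr (hj₀ j))
  linear_combination (-(U i j * U k j)) * this

/-- The matrix `R` with every row and column outside `S` replaced by that of the identity. Its
determinant is the principal minor of `R` on `S`; keeping the full size avoids submatrices. -/
def principalPart (S : Finset ι) (R : Matrix ι ι ℝ) : Matrix ι ι ℝ :=
  of fun i j => if i ∈ S ∧ j ∈ S then R i j else if i = j then 1 else 0

lemma principalPart_eq (S : Finset ι) (R : Matrix ι ι ℝ) :
    principalPart S R = diagonal (fun i => if i ∈ S then 1 else 0) * R *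
      diagonal (fun i => if i ∈ S then 1 else 0) + diagonal (fun i => if i ∈ S then 0 else 1) := by
  ext i j
  by_cases hi : i ∈ S <;> by_cases hj : j ∈ S <;> by_cases hij : i = j <;>
    simp_all [principalPart]

lemma posSemidef_principalPart (S : Finset ι) {R : Matrix ι ι ℝ} (hR : R.PosSemidef) :
    (principalPart S R).PosSemidef := by
  rw [principalPart_eq]
  refine PosSemidef.add ?_ (PosSemidef.diagonal fun i => ?_)
  · simpa using hR.mul_mul_conjTranspose_same (diagonal (fun i => if i ∈ S then (1 : ℝ) else 0))
  · simp only [Pi.zero_apply]; split_ifs <;> norm_num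

lemma det_piecewise_one (S : Finset ι) (R : Matrix ι ι ℝ) :
    (of fun i j => if i ∈ S then R i j else (1 : Matrix ι ι ℝ) i j).det =
      (principalPart S R).det := by
  set P : Matrix ι ι ℝ := diagonal (fun i => if i ∈ S then 1 else 0) with hP
  set Q : Matrix ι ι ℝ := diagonal (fun i => if i ∈ S then 0 else 1) with hQ
  have hQP : Q * P = 0 := by
    rw [hP, hQ, diagonal_mul_diagonal, ← diagonal_zero]
    congr 1; ext i; by_cases h : i ∈ S <;> simp [h]
  have hQQ : Q * Q = Q := by
    rw [hQ, diagonal_mul_diagonal]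
    congr 1; ext i; by_cases h : i ∈ S <;> simp [h]
  have hPQ : P + Q = 1 := by
    rw [hP, hQ, diagonal_add, ← diagonal_one]
    congr 1; ext i; by_cases h : i ∈ S <;> simp [h]
  have h1 : (of fun i j => if i ∈ S then R i j else (1 : Matrix ι ι ℝ) i j) = P * R + Q := by
    ext i j
    by_cases h : i ∈ S
    · simp [h, P, Q, diagonal_apply]
    · simp [h, P, Q, diagonal_apply, one_apply]
  -- The entries of `P R` in the columns outside `S` are removed by a unipotent factor.
  have h2 : P * R + Q = (1 + P * (R * Q)) * (P * R * P + Q) := by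
    have h3 : P * (R * Q) * (P * R * P + Q) = P * R * Q := by
      calc _ = P * R * (Q * P) * R * P + P * R * (Q * Q) := by noncomm_ring
        _ = _ := by rw [hQP, hQQ]; simp
    rw [add_mul, one_mul, h3]
    calc _ = P * R * (P + Q) + Q := by rw [hPQ, mul_one]
      _ = _ := by noncomm_ring
  rw [h1, h2, det_mul, det_one_add_mul_comm, Matrix.mul_assoc, hQP, Matrix.mul_zero, add_zero,
    det_one, one_mul, principalPart_eq]

/-- Expansion of `|I + R T|` into principal minors of `R`. -/
lemma det_one_add_mul_diagonal (R : Matrix ι ι ℝ) (t : ι → ℝ) :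
    (1 + R * diagonal t).det = ∑ S : Finset ι, (∏ i ∈ S, t i) * (principalPart S R).det := by
  rw [det_one_add_mul_comm]
  let m : ι → ι → ℝ := fun i j => R i j
  let e : ι → ι → ℝ := fun i j => (1 : Matrix ι ι ℝ) i j
  have h : (1 + diagonal t * R : Matrix ι ι ℝ) = of ((fun i => t i • m i) + e) := by
    ext i j; simp [add_comm, m, e]
  rw [h]
  change detRowAlternating ((fun i => t i • m i) + e) = _
  rw [AlternatingMap.map_add_univ]
  refine Finset.sum_congr rfl fun S _ => ?_
  have h2 : S.piecewise (fun i => t i • m i) e =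
      S.piecewise (fun i => t i • (S.piecewise m e) i) (S.piecewise m e) := by
    ext i j
    by_cases hi : i ∈ S <;> simp [hi]
  have h3 := (detRowAlternating (R := ℝ) (n := ι)).map_piecewise_smul t (S.piecewise m e) S
  rw [h2]
  refine h3.trans ?_
  rw [← det_piecewise_one, smul_eq_mul]
  congr 1
  change det _ = det _
  congr 1
  ext i j
  by_cases hi : i ∈ S <;> simp [hi, m, e]

omit [Fintype ι] in
lemma principalPart_empty (R : Matrix ι ι ℝ) : principalPart ∅ R = 1 := by
  ext i j; simp [principalPart, one_apply]

lemma one_le_det_one_add {W : Matrix ι ι ℝ} (hW : W.PosSemidef) : 1 ≤ (1 + W).det := by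
  have h := det_one_add_mul_diagonal W (fun _ => 1)
  simp only [diagonal_one, Matrix.mul_one, Finset.prod_const_one, one_mul] at h
  rw [h]
  calc (1 : ℝ) = (principalPart ∅ W).det := by simp [principalPart_empty]
    _ ≤ _ := Finset.single_le_sum (f := fun S => (principalPart S W).det)
      (fun S _ => (posSemidef_principalPart S hW).det_nonneg) (Finset.mem_univ ∅)

lemma det_le_det_add {X Z : Matrix ι ι ℝ} (hX : X.PosSemidef) (hZ : Z.PosSemidef) :
    X.det ≤ (X + Z).det := by
  obtain ⟨C, hC⟩ := exists_eq_transpose_mul_self hX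
  by_cases h : X.det = 0
  · rw [h]; exact (hX.add hZ).det_nonneg
  have hCdet : IsUnit C.det := by
    rw [isUnit_iff_ne_zero]; rintro h0
    exact h (by rw [hC, det_mul, h0, mul_zero])
  have hCt : IsUnit Cᵀ.det := by rwa [det_transpose]
  have hW : (C⁻¹ᵀ * Z * C⁻¹).PosSemidef := by
    simpa [conjTranspose_eq_transpose_of_trivial] using hZ.conjTranspose_mul_mul_same C⁻¹
  have h1 : X + Z = Cᵀ * (1 + C⁻¹ᵀ * Z * C⁻¹) * C := by
    have e1 : Cᵀ * C⁻¹ᵀ = 1 := by rw [← transpose_mul, nonsing_inv_mul _ hCdet, transpose_one]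
    have e2 : C⁻¹ * C = 1 := nonsing_inv_mul _ hCdet
    calc X + Z = Cᵀ * C + (Cᵀ * C⁻¹ᵀ) * Z * (C⁻¹ * C) := by rw [e1, e2, hC]; simp
      _ = _ := by noncomm_ring
  rw [h1, det_mul, det_mul, hC, det_mul]
  have := one_le_det_one_add hW
  have h2 : 0 ≤ Cᵀ.det * C.det := by rw [det_transpose]; exact mul_self_nonneg _
  nlinarith

/-- The matrix `R` with its two off-diagonal blocks multiplied by `τ`. -/
def crossScale (τ : ℝ) (R : Matrix (ι₁ ⊕ ι₂) (ι₁ ⊕ ι₂) ℝ) : Matrix (ι₁ ⊕ ι₂) (ι₁ ⊕ ι₂) ℝ :=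
  of fun i j => (if i.isLeft = j.isLeft then 1 else τ) * R i j

omit [Fintype ι₁] [DecidableEq ι₁] [Fintype ι₂] [DecidableEq ι₂] in
lemma crossScale_eq_fromBlocks (τ : ℝ) (R : Matrix (ι₁ ⊕ ι₂) (ι₁ ⊕ ι₂) ℝ) :
    crossScale τ R =
      fromBlocks R.toBlocks₁₁ (τ • R.toBlocks₁₂) (τ • R.toBlocks₂₁) R.toBlocks₂₂ := by
  ext (i | i) (j | j) <;> simp [crossScale, toBlocks₁₁, toBlocks₁₂, toBlocks₂₁, toBlocks₂₂]

omit [Fintype ι₁] [DecidableEq ι₁] [Fintype ι₂] [DecidableEq ι₂] in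
lemma crossScale_one (R : Matrix (ι₁ ⊕ ι₂) (ι₁ ⊕ ι₂) ℝ) : crossScale 1 R = R := by
  ext i j; simp [crossScale]

omit [Fintype ι₁] [Fintype ι₂] in
lemma crossScale_smul_one_add (τ c : ℝ) (A : Matrix (ι₁ ⊕ ι₂) (ι₁ ⊕ ι₂) ℝ) :
    crossScale τ (c • 1 + A) = c • 1 + crossScale τ A := by
  ext i j
  by_cases h : i = j
  · subst h; simp [crossScale]
  · simp [crossScale, one_apply_ne h]

omit [Fintype ι₁] [Fintype ι₂] in
lemma principalPart_crossScale (S : Finset (ι₁ ⊕ ι₂)) (τ : ℝ)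
    (R : Matrix (ι₁ ⊕ ι₂) (ι₁ ⊕ ι₂) ℝ) :
    principalPart S (crossScale τ R) = crossScale τ (principalPart S R) := by
  ext i j
  by_cases hij : i = j
  · subst hij; by_cases h : i ∈ S <;> simp [principalPart, crossScale, h]
  · by_cases h : i ∈ S ∧ j ∈ S <;> simp [principalPart, crossScale, h, hij]

lemma posSemidef_crossScale {R : Matrix (ι₁ ⊕ ι₂) (ι₁ ⊕ ι₂) ℝ} (hR : R.PosSemidef) {τ : ℝ}
    (h0 : 0 ≤ τ) (h1 : τ ≤ 1) : (crossScale τ R).PosSemidef := by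
  -- a convex combination of `R` and of its conjugate by a diagonal sign matrix
  let J : Matrix (ι₁ ⊕ ι₂) (ι₁ ⊕ ι₂) ℝ := diagonal (Sum.elim 1 (-1))
  have hJ : (J * R * J).PosSemidef := by
    simpa [J] using hR.mul_mul_conjTranspose_same J
  have : crossScale τ R = ((1 + τ) / 2) • R + ((1 - τ) / 2) • (J * R * J) := by
    ext (i | i) (j | j) <;> simp [crossScale, J] <;> ring
  rw [this]
  exact (hR.smul (by linarith)).add (hJ.smul (by linarith))

/-- Scaling up the cross-correlations lowers the determinant. -/
lemma antitoneOn_det_crossScale {R : Matrix (ι₁ ⊕ ι₂) (ι₁ ⊕ ι₂) ℝ} (hR : R.PosSemidef)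
    (h11 : R.toBlocks₁₁.PosDef) :
    AntitoneOn (fun τ => (crossScale τ R).det) (Set.Icc 0 1) := by
  intro σ hσ τ hτ hστ
  have h21 : R.toBlocks₂₁ = R.toBlocks₁₂ᵀ := by
    ext i j
    have := hR.1.apply (Sum.inr i) (Sum.inl j)
    simpa [toBlocks₂₁, toBlocks₁₂] using this.symm
  have hinv : IsUnit R.toBlocks₁₁.det := h11.det_pos.ne'.isUnit
  let _ := invertibleOfIsUnitDet _ hinv
  have hdet : ∀ x : ℝ, (crossScale x R).det = R.toBlocks₁₁.det *
      (R.toBlocks₂₂ - x ^ 2 • (R.toBlocks₁₂ᵀ * R.toBlocks₁₁⁻¹ * R.toBlocks₁₂)).det := by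
    intro x
    rw [crossScale_eq_fromBlocks, det_fromBlocks₁₁, h21, invOf_eq_nonsing_inv]
    congr 2
    simp [smul_smul, pow_two]
  have hX : (R.toBlocks₂₂ -
      τ ^ 2 • (R.toBlocks₁₂ᵀ * R.toBlocks₁₁⁻¹ * R.toBlocks₁₂)).PosSemidef := by
    have h := posSemidef_crossScale hR hτ.1 hτ.2
    rw [crossScale_eq_fromBlocks, h21] at h
    have h2 := (PosDef.fromBlocks₁₁ (τ • R.toBlocks₁₂) R.toBlocks₂₂ h11).mp (by
      simpa [conjTranspose_eq_transpose_of_trivial] using h)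
    simpa [conjTranspose_eq_transpose_of_trivial, smul_smul, pow_two] using h2
  have hK : (R.toBlocks₁₂ᵀ * R.toBlocks₁₁⁻¹ * R.toBlocks₁₂).PosSemidef := by
    simpa [conjTranspose_eq_transpose_of_trivial] using
      h11.inv.posSemidef.conjTranspose_mul_mul_same R.toBlocks₁₂
  have hle : 0 ≤ τ ^ 2 - σ ^ 2 := by nlinarith [hσ.1, hτ.1]
  simp only [hdet]
  refine mul_le_mul_of_nonneg_left ?_ h11.det_pos.le
  have h := det_le_det_add hX (hK.smul hle)
  rwa [sub_smul, sub_add_sub_cancel] at h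

lemma det_principalPart_pair {R : Matrix ι ι ℝ} (hdiag : ∀ i, R i i = 1) (hsymm : R.IsSymm)
    {i j : ι} (hij : i ≠ j) : (principalPart {i, j} R).det = 1 - R i j ^ 2 := by
  set r := R i j
  have hr : R j i = r := hsymm.apply i j
  have h1 : transvection i j (-r) * principalPart {i, j} R =
      diagonal (Function.update 1 i (1 - r ^ 2)) * transvection j i r := by
    have : principalPart {i, j} R = 1 + single i j r + single j i r := by
      ext a b
      by_cases hab : a = b
      · subst hab
        have h1 : ¬(i = a ∧ j = a) := fun h => hij (h.1.trans h.2.symm)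
        have h2 : ¬(j = a ∧ i = a) := fun h => hij (h.2.trans h.1.symm)
        simp [principalPart, hdiag, h1, h2]
      · by_cases ha : a = i
        · subst ha
          by_cases hb : j = b
          · subst hb; simp [principalPart, hab, r]
          · simp [principalPart, hb, Ne.symm hb, hab, Ne.symm hab, hij.symm]
        · by_cases ha' : a = j
          · subst ha'
            by_cases hb : i = b
            · subst hb; simp [principalPart, hab, hr, hij]
            · simp [principalPart, hb, Ne.symm hb, hab, Ne.symm hab, hij]
          · simp [principalPart, hab, ha, ha', Ne.symm ha, Ne.symm ha']
    have hd : diagonal (Function.update 1 i (1 - r ^ 2)) = 1 - single i i (r ^ 2) := by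
      ext a b
      by_cases ha : a = i <;> by_cases hb : a = b <;>
        simp_all [one_apply, eq_comm]
    rw [this, hd, transvection, transvection]
    have e1 : single i j (-r) * single i j r = 0 := single_mul_single_of_ne _ _ _ _ hij.symm _
    have e2 : single i j (-r) * single j i r = - single i i (r ^ 2) := by
      rw [single_mul_single_same, single_neg]; congr 1; ring
    have e3 : single i i (r ^ 2) * single j i r = 0 := single_mul_single_of_ne _ _ _ _ hij _
    simp only [add_mul, mul_add, sub_mul, one_mul, mul_one, e1, e2, e3]
    have e4 : single i j (-r) = - single i j r := (single_neg ..).symm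
    rw [e4]; abel
  have h2 := congrArg det h1
  rw [det_mul, det_mul, det_transvection_of_ne _ _ hij, det_transvection_of_ne _ _ hij.symm,
    det_diagonal] at h2
  simpa [Finset.prod_update_of_mem] using h2

/-! ### Laplace transforms and uniqueness -/

omit [DecidableEq ι] in
lemma measurable_exp_neg_sum (t : ι → ℝ) :
    Measurable fun x : ι → ℝ => Real.exp (-∑ i, t i * x i) := by fun_prop

omit [DecidableEq ι] in
lemma integrable_exp_neg_sum {μ : Measure (ι → ℝ)} [IsFiniteMeasure μ]
    (hμ : ∀ᵐ x ∂μ, ∀ i, 0 ≤ x i) {t : ι → ℝ} (ht : ∀ i, 0 ≤ t i) :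
    Integrable (fun x => Real.exp (-∑ i, t i * x i)) μ := by
  refine Integrable.of_bound (C := 1) (measurable_exp_neg_sum t).aestronglyMeasurable ?_
  filter_upwards [hμ] with x hx
  rw [Real.norm_eq_abs, abs_of_nonneg (Real.exp_nonneg _), Real.exp_le_one_iff]
  simpa using Finset.sum_nonneg fun i _ => mul_nonneg (ht i) (hx i)

lemma lintegral_exp_neg {α : ℝ} {R : Matrix ι ι ℝ} {μ : Measure (ι → ℝ)}
    (h : IsMultivariateGamma α R μ) {t : ι → ℝ} (ht : ∀ i, 0 ≤ t i) :
    ∫⁻ x, ENNReal.ofReal (Real.exp (-∑ i, t i * x i)) ∂μ =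
      ENNReal.ofReal ((1 + R * diagonal t).det ^ (-α)) := by
  have := h.isProbabilityMeasure
  rw [← h.laplace t ht, ofReal_integral_eq_lintegral_ofReal (integrable_exp_neg_sum h.nonneg ht)
    (Filter.Eventually.of_forall fun _ => Real.exp_nonneg _)]

lemma isMultivariateGamma_of_lintegral {α : ℝ} {R : Matrix ι ι ℝ} (hR : R.PosSemidef)
    {μ : Measure (ι → ℝ)} (h0 : ∀ᵐ x ∂μ, ∀ i, 0 ≤ x i)
    (h : ∀ t : ι → ℝ, (∀ i, 0 ≤ t i) → ∫⁻ x, ENNReal.ofReal (Real.exp (-∑ i, t i * x i)) ∂μ =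
      ENNReal.ofReal ((1 + R * diagonal t).det ^ (-α))) : IsMultivariateGamma α R μ where
  isProbabilityMeasure := ⟨by simpa using h 0 (by simp)⟩
  nonneg := h0
  laplace t ht := by
    rw [integral_eq_lintegral_of_nonneg_ae (Filter.Eventually.of_forall fun _ => Real.exp_nonneg _)
      (measurable_exp_neg_sum t).aestronglyMeasurable, h t ht, ENNReal.toReal_ofReal]
    exact Real.rpow_nonneg (det_one_add_mul_diagonal_pos hR ht).le _

lemma measurable_gammaPDF (a r : ℝ) : Measurable (gammaPDF a r) :=
  (measurable_gammaPDFReal a r).ennreal_ofReal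

lemma lintegral_exp_neg_gammaMeasure {a r s : ℝ} (ha : 0 < a) (hr : 0 < r) (hs : 0 < r + s) :
    ∫⁻ x, ENNReal.ofReal (Real.exp (-(s * x))) ∂gammaMeasure a r =
      ENNReal.ofReal ((r / (r + s)) ^ a) := by
  rw [gammaMeasure, lintegral_withDensity_eq_lintegral_mul _ (measurable_gammaPDF a r)
    (by fun_prop)]
  have : ∀ x, (gammaPDF a r * fun x => ENNReal.ofReal (Real.exp (-(s * x)))) x =
      ENNReal.ofReal ((r / (r + s)) ^ a) * gammaPDF a (r + s) x := by
    intro x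
    rcases lt_or_ge x 0 with hx | hx
    · simp [gammaPDF_of_neg hx]
    · rw [Pi.mul_apply, gammaPDF_of_nonneg hx, gammaPDF_of_nonneg hx,
        ← ENNReal.ofReal_mul (by positivity), ← ENNReal.ofReal_mul (by positivity)]
      congr 1
      rw [Real.div_rpow hr.le hs.le, add_mul, neg_add, Real.exp_add]
      field_simp
  simp_rw [this]
  rw [lintegral_const_mul _ (measurable_gammaPDF a (r + s)),
    lintegral_gammaPDF_eq_one ha hs, mul_one]

lemma gammaMeasure_ae_nonneg (a r : ℝ) : ∀ᵐ x ∂gammaMeasure a r, 0 ≤ x := by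
  rw [ae_iff]
  have : {x : ℝ | ¬ 0 ≤ x} = Set.Iio 0 := by ext; simp
  rw [this, gammaMeasure, withDensity_apply _ measurableSet_Iio,
    lintegral_gammaPDF_of_nonpos le_rfl]

/-- The product of independent gamma laws with shapes `a i` and common rate `r`. -/
noncomputable def gammaProduct (a : ι → ℝ) (r : ℝ) : Measure (ι → ℝ) :=
  Measure.pi fun i => gammaMeasure (a i) r

omit [DecidableEq ι] in
lemma gammaProduct_ae_nonneg {a : ι → ℝ} {r : ℝ} (ha : ∀ i, 0 < a i) (hr : 0 < r) :
    ∀ᵐ x ∂gammaProduct a r, ∀ i, 0 ≤ x i := by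
  have := fun i => isProbabilityMeasure_gammaMeasure (ha i) hr
  rw [ae_all_iff]
  exact fun i => (Measure.quasiMeasurePreserving_eval (fun i => gammaMeasure (a i) r) i).ae
    (gammaMeasure_ae_nonneg (a i) r)

omit [DecidableEq ι] in
lemma isProbabilityMeasure_gammaProduct {a : ι → ℝ} {r : ℝ} (ha : ∀ i, 0 < a i) (hr : 0 < r) :
    IsProbabilityMeasure (gammaProduct a r) := by
  have := fun i => isProbabilityMeasure_gammaMeasure (ha i) hr
  unfold gammaProduct
  infer_instance

omit [DecidableEq ι] in
lemma lintegral_exp_neg_gammaProduct {a : ι → ℝ} {r : ℝ} (ha : ∀ i, 0 < a i) (hr : 0 < r)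
    {t : ι → ℝ} (ht : ∀ i, 0 ≤ t i) :
    ∫⁻ x, ENNReal.ofReal (Real.exp (-∑ i, t i * x i)) ∂gammaProduct a r =
      ENNReal.ofReal (∏ i, (r / (r + t i)) ^ a i) := by
  have := fun i => isProbabilityMeasure_gammaMeasure (ha i) hr
  have := isProbabilityMeasure_gammaProduct ha hr
  rw [← ofReal_integral_eq_lintegral_ofReal
    (integrable_exp_neg_sum (gammaProduct_ae_nonneg ha hr) ht)
    (Filter.Eventually.of_forall fun _ => Real.exp_nonneg _)]
  congr 1
  simp_rw [← Finset.sum_neg_distrib, Real.exp_sum]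
  rw [gammaProduct, integral_fintype_prod_eq_prod (fun i x => Real.exp (-(t i * x)))]
  refine Finset.prod_congr rfl fun i _ => ?_
  have hpos : 0 < r + t i := by linarith [ht i]
  rw [integral_eq_lintegral_of_nonneg_ae (Filter.Eventually.of_forall fun _ => Real.exp_nonneg _)
    (by fun_prop), lintegral_exp_neg_gammaMeasure (ha i) hr hpos, ENNReal.toReal_ofReal]
  positivity

/-- The function `x ↦ exp (-xᵢ)` on the nonnegative orthant. -/
noncomputable def expNegCoord (i : ι) : BoundedContinuousFunction (ι → ℝ≥0) ℝ :=
  BoundedContinuousFunction.ofNormedAddCommGroup (fun x => Real.exp (-(x i : ℝ))) (by fun_prop) 1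
    (fun x => by simp [abs_of_nonneg (Real.exp_nonneg _)])

/-- A finite measure on the nonnegative orthant is determined by the values of its Laplace
transform at integer points: by Stone–Weierstrass, the algebra generated by the functions
`exp (-xᵢ)` separates finite measures. -/
lemma ext_of_laplace {P Q : Measure (ι → ℝ≥0)} [IsFiniteMeasure P] [IsFiniteMeasure Q]
    (h : ∀ k : ι → ℕ, ∫ x, Real.exp (-∑ i, (k i : ℝ) * (x i : ℝ)) ∂P =
      ∫ x, Real.exp (-∑ i, (k i : ℝ) * (x i : ℝ)) ∂Q) : P = Q := by
  let s : Set (BoundedContinuousFunction (ι → ℝ≥0) ℝ) := Set.range expNegCoord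
  have hstar : ∀ f : BoundedContinuousFunction (ι → ℝ≥0) ℝ, star f = f := fun f => by ext; simp
  let A : StarSubalgebra ℝ (BoundedContinuousFunction (ι → ℝ≥0) ℝ) :=
    { Algebra.adjoin ℝ s with star_mem' := fun {f} hf => (hstar f).symm ▸ hf }
  refine ext_of_forall_mem_subalgebra_integral_eq_of_polish (𝕜 := ℝ) (A := A) ?_ ?_
  · intro x y hxy
    obtain ⟨i, hi⟩ := Function.ne_iff.mp hxy
    refine ⟨expNegCoord i, ⟨_, ⟨expNegCoord i, Algebra.subset_adjoin ⟨i, rfl⟩, rfl⟩, rfl⟩, ?_⟩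
    simpa [expNegCoord] using hi
  · intro g hg
    have hg' : g ∈ Submodule.span ℝ (Submonoid.closure s : Set _) := by
      rw [← Algebra.adjoin_eq_span]; exact hg
    clear hg
    induction hg' using Submodule.span_induction with
    | mem f hf =>
      have : ∃ k : ι → ℕ, ∀ x : ι → ℝ≥0, f x = Real.exp (-∑ i, (k i : ℝ) * (x i : ℝ)) := by
        induction hf using Submonoid.closure_induction with
        | mem f hf =>
          obtain ⟨i, rfl⟩ := hf
          exact ⟨Pi.single i 1, fun x => by simp [expNegCoord, Pi.single_apply]⟩
        | one => exact ⟨0, fun x => by simp⟩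
        | mul f g _ _ hf hg =>
          obtain ⟨k, hk⟩ := hf
          obtain ⟨l, hl⟩ := hg
          refine ⟨k + l, fun x => ?_⟩
          simp only [BoundedContinuousFunction.mul_apply, hk, hl, ← Real.exp_add, Pi.add_apply,
            Nat.cast_add, add_mul, Finset.sum_add_distrib, neg_add]
      obtain ⟨k, hk⟩ := this
      simp_rw [hk]
      exact h k
    | zero => simp
    | add f g _ _ hf hg =>
      simp only [BoundedContinuousFunction.add_apply]
      rw [integral_add (f.integrable _) (g.integrable _), integral_add (f.integrable _)
        (g.integrable _), hf, hg]
    | smul c f _ hf =>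
      simp only [BoundedContinuousFunction.smul_apply]
      rw [integral_smul, integral_smul, hf]

lemma isMultivariateGamma_unique {α : ℝ} {R : Matrix ι ι ℝ} {μ ν : Measure (ι → ℝ)}
    (hμ : IsMultivariateGamma α R μ) (hν : IsMultivariateGamma α R ν) : μ = ν := by
  let f : (ι → ℝ) → (ι → ℝ≥0) := fun x i => (x i).toNNReal
  let g : (ι → ℝ≥0) → (ι → ℝ) := fun x i => x i
  have hf : Measurable f := by fun_prop
  have hg : Measurable g := by fun_prop
  have hback : ∀ {ρ : Measure (ι → ℝ)}, IsMultivariateGamma α R ρ → (ρ.map f).map g = ρ := by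
    intro ρ hρ
    rw [Measure.map_map hg hf]
    conv_rhs => rw [← Measure.map_id (μ := ρ)]
    refine Measure.map_congr ?_
    filter_upwards [hρ.nonneg] with x hx
    ext i
    simp [f, g, hx i]
  have hlap : ∀ {ρ : Measure (ι → ℝ)}, IsMultivariateGamma α R ρ → ∀ k : ι → ℕ,
      ∫ x, Real.exp (-∑ i, (k i : ℝ) * (x i : ℝ)) ∂(ρ.map f) =
        (1 + R * diagonal (fun i => (k i : ℝ))).det ^ (-α) := by
    intro ρ hρ k
    rw [← hρ.laplace _ (fun i => Nat.cast_nonneg _), integral_map hf.aemeasurable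
      (by apply Measurable.aestronglyMeasurable; fun_prop)]
    refine integral_congr_ae ?_
    filter_upwards [hρ.nonneg] with x hx
    simp [f, hx]
  have := hμ.isProbabilityMeasure
  have := hν.isProbabilityMeasure
  rw [← hback hμ, ← hback hν]
  congr 1
  exact ext_of_laplace fun k => by rw [hlap hμ, hlap hν]

/-! ### Gram matrices and the Bartlett decomposition -/

lemma lintegral_exp_neg_half_dotProduct_self (m : ℕ) :
    ∫⁻ x : Fin m → ℝ, ENNReal.ofReal (Real.exp (-(1 / 2) * (x ⬝ᵥ x))) =
      ENNReal.ofReal (√(2 * Real.pi) ^ m) := by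
  have h : ∀ x : Fin m → ℝ, Real.exp (-(1 / 2) * (x ⬝ᵥ x)) =
      ∏ i, Real.exp (-(1 / 2) * x i ^ 2) := by
    intro x
    rw [← Real.exp_sum, dotProduct, Finset.mul_sum]
    simp_rw [pow_two]
  simp_rw [h]
  have hint : Integrable (fun x : ℝ => Real.exp (-(1 / 2) * x ^ 2)) :=
    integrable_exp_neg_mul_sq (by norm_num)
  rw [volume_pi, ← ofReal_integral_eq_lintegral_ofReal
    (Integrable.fintype_prod (f := fun _ x => Real.exp (-(1 / 2) * x ^ 2)) fun _ => hint)
    (Filter.Eventually.of_forall fun _ => Finset.prod_nonneg fun _ _ => Real.exp_nonneg _),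
    ← volume_pi, integral_fintype_prod_volume_eq_pow (fun x => Real.exp (-(1 / 2) * x ^ 2)),
    integral_gaussian, Fintype.card_fin]
  congr 4
  ring

/-- Gaussian integral of a positive definite quadratic form with a linear term. -/
lemma lintegral_exp_neg_quadratic {m : ℕ} {Q : Matrix (Fin m) (Fin m) ℝ} (hQ : Q.PosDef)
    (v : Fin m → ℝ) :
    ∫⁻ x : Fin m → ℝ, ENNReal.ofReal (Real.exp (-(1 / 2) * (x ⬝ᵥ Q *ᵥ x) - v ⬝ᵥ x)) =
      ENNReal.ofReal (√(2 * Real.pi) ^ m * Q.det ^ (-(1 / 2) : ℝ) *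
        Real.exp (1 / 2 * (v ⬝ᵥ Q⁻¹ *ᵥ v))) := by
  obtain ⟨C, hC⟩ := exists_eq_transpose_mul_self hQ.posSemidef
  have hCdet : C.det ≠ 0 := fun h0 => hQ.det_pos.ne' (by rw [hC, det_mul, h0, mul_zero])
  have hQu : Q *ᵥ (Q⁻¹ *ᵥ v) = v := by
    rw [mulVec_mulVec, mul_nonsing_inv _ hQ.det_pos.ne'.isUnit, one_mulVec]
  set u := Q⁻¹ *ᵥ v with hu
  have hsq : ∀ y, (C *ᵥ y) ⬝ᵥ (C *ᵥ y) = y ⬝ᵥ Q *ᵥ y := by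
    intro y
    rw [hC, ← mulVec_mulVec, dotProduct_mulVec, dotProduct_mulVec, vecMul_transpose]
    rw [← dotProduct_mulVec]
  have hsymm : ∀ y z, y ⬝ᵥ Q *ᵥ z = z ⬝ᵥ Q *ᵥ y := by
    intro y z
    have hT : Qᵀ = Q := by
      have := hQ.1
      rwa [IsHermitian, conjTranspose_eq_transpose_of_trivial] at this
    rw [dotProduct_mulVec, ← mulVec_transpose, hT, dotProduct_comm]
  have h1 : ∀ x, Real.exp (-(1 / 2) * (x ⬝ᵥ Q *ᵥ x) - v ⬝ᵥ x) =
      Real.exp (1 / 2 * (v ⬝ᵥ u)) *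
        Real.exp (-(1 / 2) * ((C *ᵥ (x + u)) ⬝ᵥ (C *ᵥ (x + u)))) := by
    intro x
    rw [← Real.exp_add, hsq, mulVec_add, dotProduct_add, add_dotProduct, add_dotProduct, hQu,
      hsymm u x, hQu, dotProduct_comm x v, dotProduct_comm u v]
    congr 1; ring
  have hG : Measurable fun y : Fin m → ℝ =>
      ENNReal.ofReal (Real.exp (-(1 / 2) * (y ⬝ᵥ y))) := by
    unfold dotProduct; fun_prop
  have h2 : ∫⁻ x : Fin m → ℝ, ENNReal.ofReal (Real.exp (-(1 / 2) * ((C *ᵥ x) ⬝ᵥ (C *ᵥ x)))) =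
      ENNReal.ofReal |(C.det)⁻¹| * ENNReal.ofReal (√(2 * Real.pi) ^ m) := by
    have hlin : Measurable (toLin' C) := (LinearMap.continuous_of_finiteDimensional _).measurable
    have := lintegral_map (μ := volume) hG hlin
    simp only [toLin'_apply] at this
    rw [← this, Real.map_matrix_volume_pi_eq_smul_volume_pi hCdet, lintegral_smul_measure,
      lintegral_exp_neg_half_dotProduct_self, smul_eq_mul]
  have h3 : Q.det ^ (-(1 / 2) : ℝ) = |(C.det)⁻¹| := by
    rw [hC, det_mul, det_transpose, Real.rpow_neg (mul_self_nonneg _), ← Real.sqrt_eq_rpow,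
      Real.sqrt_mul_self_eq_abs, abs_inv]
  simp_rw [h1, ENNReal.ofReal_mul (Real.exp_nonneg _)]
  rw [lintegral_const_mul']
  · rw [lintegral_add_right_eq_self (μ := volume)
      (fun x => ENNReal.ofReal (Real.exp (-(1 / 2) * ((C *ᵥ x) ⬝ᵥ (C *ᵥ x))))) u, h2, h3,
      ← ENNReal.ofReal_mul (abs_nonneg _), ← ENNReal.ofReal_mul (Real.exp_nonneg _)]
    congr 1; ring
  · exact ENNReal.ofReal_ne_top

/-- Adding a rank-one term `b bᵀ` to a Gram matrix multiplies `|I + R T|` by a scalar Schur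
complement. -/
lemma det_one_add_gram_add_vecMulVec {m : ℕ} (B : Matrix (Fin m) ι ℝ) (b t : ι → ℝ)
    (hD : (1 + B * diagonal t * Bᵀ).det ≠ 0) :
    (1 + (Bᵀ * B + vecMulVec b b) * diagonal t).det = (1 + B * diagonal t * Bᵀ).det *
      (1 + (b ⬝ᵥ diagonal t *ᵥ b - (B *ᵥ diagonal t *ᵥ b) ⬝ᵥ
        (1 + B * diagonal t * Bᵀ)⁻¹ *ᵥ (B *ᵥ diagonal t *ᵥ b))) := by
  let E : Matrix (Unit ⊕ Fin m) ι ℝ := fromRows (replicateRow Unit b) B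
  have hE : Bᵀ * B + vecMulVec b b = Eᵀ * E := by
    rw [transpose_fromRows, fromCols_mul_fromRows, add_comm]
    congr 1
    ext i j; simp [vecMulVec_apply, mul_apply]
  have hE2 : 1 + E * (diagonal t * Eᵀ) =
      fromBlocks (1 + replicateRow Unit b * (diagonal t * (replicateRow Unit b)ᵀ))
        (replicateRow Unit b * (diagonal t * Bᵀ)) (B * (diagonal t * (replicateRow Unit b)ᵀ))
        (1 + B * (diagonal t * Bᵀ)) := by
    rw [transpose_fromRows, mul_fromCols, fromRows_mul_fromCols, ← fromBlocks_one, fromBlocks_add]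
    simp
  rw [Matrix.mul_assoc] at hD
  let _ := invertibleOfIsUnitDet _ hD.isUnit
  rw [hE, Matrix.mul_assoc, det_one_add_mul_comm, Matrix.mul_assoc, hE2, det_fromBlocks₂₂,
    invOf_eq_nonsing_inv, Matrix.mul_assoc B]
  congr 1
  rw [det_unique (n := Unit), transpose_replicateRow, ← replicateCol_mulVec (diagonal t),
    ← replicateCol_mulVec B,
    ← replicateRow_vecMul (diagonal t * Bᵀ),
    ← replicateRow_vecMul (1 + B * (diagonal t * Bᵀ))⁻¹, Matrix.sub_apply, Matrix.add_apply,
    one_apply_eq, replicateRow_mul_replicateCol_apply, replicateRow_mul_replicateCol_apply,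
    add_sub_assoc,
    ← dotProduct_mulVec]
  congr 3
  rw [← mulVec_transpose, transpose_mul, transpose_transpose, diagonal_transpose, mulVec_mulVec]

/-- The inductive step of the Bartlett decomposition. The first column of the triangular factor has
leading entry `√(2g)`, with `g` of gamma law of shape `α`, and independent standard Gaussian entries
`z` below it. It contributes `(√(2g) bᵢ + (z B)ᵢ)² / 2` to the `i`-th coordinate; the remaining
columns contribute an independent vector with law `Γ(α - 1/2, BᵀB)`. -/
lemma exists_isMultivariateGamma_add_vecMulVec {m : ℕ} {α : ℝ} (hα : 0 < α)
    (B : Matrix (Fin m) ι ℝ) (b : ι → ℝ) {κ : Measure (ι → ℝ)}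
    (hκ : IsMultivariateGamma (α - 1 / 2) (Bᵀ * B) κ) :
    ∃ μ, IsMultivariateGamma α (Bᵀ * B + vecMulVec b b) μ := by
  have := hκ.isProbabilityMeasure
  have := isProbabilityMeasure_gammaMeasure hα one_pos
  -- `w` is the standard Gaussian density with respect to Lebesgue measure
  let w : (Fin m → ℝ) → ℝ≥0∞ := fun z =>
    ENNReal.ofReal ((√(2 * Real.pi) ^ m)⁻¹ * Real.exp (-(1 / 2) * (z ⬝ᵥ z)))
  have hw : Measurable w := by unfold w dotProduct; fun_prop
  let γ : Measure (Fin m → ℝ) := volume.withDensity w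
  let φ : ℝ × (Fin m → ℝ) × (ι → ℝ) → ι → ℝ := fun p i =>
    1 / 2 * (√(2 * p.1) * b i + (p.2.1 ᵥ* B) i) ^ 2 + p.2.2 i
  have hφ : Measurable φ := by
    unfold φ vecMul dotProduct; fun_prop
  have hpsd : (Bᵀ * B + vecMulVec b b).PosSemidef := by
    refine (posSemidef_transpose_mul_self B).add ?_
    simpa using posSemidef_vecMulVec_self_star b
  refine ⟨((gammaMeasure α 1).prod (γ.prod κ)).map φ,
    isMultivariateGamma_of_lintegral hpsd ?_ ?_⟩
  · rw [ae_map_iff hφ.aemeasurable (by measurability)]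
    have hsnd := (Measure.quasiMeasurePreserving_snd (μ := gammaMeasure α 1) (ν := γ.prod κ)).ae
      ((Measure.quasiMeasurePreserving_snd (μ := γ) (ν := κ)).ae hκ.nonneg)
    filter_upwards [hsnd] with p hp i
    exact add_nonneg (by positivity) (hp i)
  · intro t ht
    set Q := 1 + B * diagonal t * Bᵀ with hQ
    have hQpos : Q.PosDef := PosDef.one.add_posSemidef (posSemidef_gram_diagonal B ht)
    set c := B *ᵥ diagonal t *ᵥ b with hc
    set h := b ⬝ᵥ diagonal t *ᵥ b - c ⬝ᵥ Q⁻¹ *ᵥ c with hh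
    have hdet := det_one_add_gram_add_vecMulVec B b t hQpos.det_pos.ne'
    have hpos := det_one_add_mul_diagonal_pos hpsd ht
    have h1 : 0 < 1 + h := by
      rw [hdet] at hpos
      exact pos_of_mul_pos_right hpos hQpos.det_pos.le
    have hsum : ∀ (a : ℝ) (z : Fin m → ℝ), ∑ i, t i * (a * b i + (z ᵥ* B) i) ^ 2 =
        a ^ 2 * (b ⬝ᵥ diagonal t *ᵥ b) + 2 * a * (c ⬝ᵥ z) + (z ⬝ᵥ Q *ᵥ z - z ⬝ᵥ z) := by
      intro a z
      have e1 : c ⬝ᵥ z = ∑ i, t i * b i * (z ᵥ* B) i := by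
        rw [hc, dotProduct_comm, dotProduct_mulVec, dotProduct]
        exact Finset.sum_congr rfl fun i _ => by rw [mulVec_diagonal]; ring
      have e2 : z ⬝ᵥ Q *ᵥ z - z ⬝ᵥ z = ∑ i, t i * (z ᵥ* B) i ^ 2 := by
        rw [hQ, add_mulVec, one_mulVec, dotProduct_add, add_sub_cancel_left, ← mulVec_mulVec,
          ← mulVec_mulVec, dotProduct_mulVec, mulVec_transpose, dotProduct]
        exact Finset.sum_congr rfl fun i _ => by rw [mulVec_diagonal]; ring
      have e3 : b ⬝ᵥ diagonal t *ᵥ b = ∑ i, t i * b i ^ 2 :=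
        Finset.sum_congr rfl fun i _ => by rw [mulVec_diagonal]; ring
      rw [e1, e2, e3, Finset.mul_sum, Finset.mul_sum, ← Finset.sum_add_distrib,
        ← Finset.sum_add_distrib]
      exact Finset.sum_congr rfl fun i _ => by ring
    have hcol : ∀ g : ℝ, 0 ≤ g → ∫⁻ z, ENNReal.ofReal (Real.exp
        (-∑ i, t i * (1 / 2 * (√(2 * g) * b i + (z ᵥ* B) i) ^ 2))) ∂γ =
        ENNReal.ofReal (Q.det ^ (-(1 / 2) : ℝ)) * ENNReal.ofReal (Real.exp (-(h * g))) := by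
      intro g hg
      have hs : √(2 * g) ^ 2 = 2 * g := Real.sq_sqrt (by positivity)
      have hv : (√(2 * g) • c) ⬝ᵥ Q⁻¹ *ᵥ (√(2 * g) • c) = 2 * g * (c ⬝ᵥ Q⁻¹ *ᵥ c) := by
        rw [mulVec_smul, dotProduct_smul, smul_dotProduct, smul_eq_mul, smul_eq_mul]
        linear_combination (c ⬝ᵥ Q⁻¹ *ᵥ c) * hs
      rw [lintegral_withDensity_eq_lintegral_mul _ hw (by unfold vecMul dotProduct; fun_prop)]
      have : ∀ z, (w * fun z => ENNReal.ofReal (Real.exp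
          (-∑ i, t i * (1 / 2 * (√(2 * g) * b i + (z ᵥ* B) i) ^ 2)))) z =
          ENNReal.ofReal ((√(2 * Real.pi) ^ m)⁻¹ *
            Real.exp (-(g * (b ⬝ᵥ diagonal t *ᵥ b)))) *
          ENNReal.ofReal (Real.exp (-(1 / 2) * (z ⬝ᵥ Q *ᵥ z) - (√(2 * g) • c) ⬝ᵥ z)) := by
        intro z
        rw [Pi.mul_apply, ← ENNReal.ofReal_mul (by positivity),
          ← ENNReal.ofReal_mul (by positivity), mul_assoc, mul_assoc, ← Real.exp_add,
          ← Real.exp_add]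
        congr 3
        have := hsum √(2 * g) z
        rw [hs] at this
        have e : ∑ i, t i * (1 / 2 * (√(2 * g) * b i + (z ᵥ* B) i) ^ 2) =
            1 / 2 * ∑ i, t i * (√(2 * g) * b i + (z ᵥ* B) i) ^ 2 := by
          rw [Finset.mul_sum]; exact Finset.sum_congr rfl fun i _ => by ring
        rw [e, this, smul_dotProduct, smul_eq_mul]
        ring
      simp_rw [this]
      rw [lintegral_const_mul' _ _ ENNReal.ofReal_ne_top, lintegral_exp_neg_quadratic hQpos, hv,
        ← ENNReal.ofReal_mul (by positivity), ← ENNReal.ofReal_mul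
          (Real.rpow_nonneg hQpos.det_pos.le _)]
      congr 1
      have hpi : √(2 * Real.pi) ^ m ≠ 0 := by positivity
      have he : Real.exp (-(h * g)) = Real.exp (-(g * (b ⬝ᵥ diagonal t *ᵥ b))) *
          Real.exp (1 / 2 * (2 * g * (c ⬝ᵥ Q⁻¹ *ᵥ c))) := by
        rw [← Real.exp_add, hh]; congr 1; ring
      rw [he]
      field_simp
    have hinner : ∀ g : ℝ, 0 ≤ g → ∫⁻ q, ENNReal.ofReal
        (Real.exp (-∑ i, t i * φ (g, q) i)) ∂(γ.prod κ) =
        ENNReal.ofReal (Q.det ^ (-(1 / 2) : ℝ)) * ENNReal.ofReal (Q.det ^ (-(α - 1 / 2))) *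
          ENNReal.ofReal (Real.exp (-(h * g))) := by
      intro g hg
      have hsplit : ∀ q : (Fin m → ℝ) × (ι → ℝ),
          ENNReal.ofReal (Real.exp (-∑ i, t i * φ (g, q) i)) =
          ENNReal.ofReal (Real.exp
            (-∑ i, t i * (1 / 2 * (√(2 * g) * b i + (q.1 ᵥ* B) i) ^ 2))) *
          ENNReal.ofReal (Real.exp (-∑ i, t i * q.2 i)) := by
        intro q
        rw [← ENNReal.ofReal_mul (Real.exp_nonneg _), ← Real.exp_add, ← neg_add,
          ← Finset.sum_add_distrib]
        simp only [φ, mul_add]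
      simp_rw [hsplit]
      rw [lintegral_prod_mul (f := fun z : Fin m → ℝ => ENNReal.ofReal (Real.exp
            (-∑ i, t i * (1 / 2 * (√(2 * g) * b i + (z ᵥ* B) i) ^ 2))))
          (g := fun y : ι → ℝ => ENNReal.ofReal (Real.exp (-∑ i, t i * y i)))
          (by apply Measurable.aemeasurable; unfold vecMul dotProduct; fun_prop)
          (measurable_exp_neg_sum t).ennreal_ofReal.aemeasurable, hcol g hg,
        lintegral_exp_neg hκ ht, Matrix.mul_assoc, det_one_add_mul_comm, mul_right_comm]
    rw [lintegral_map (measurable_exp_neg_sum t).ennreal_ofReal hφ, lintegral_prod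
      (fun p => ENNReal.ofReal (Real.exp (-∑ i, t i * φ p i)))
      ((measurable_exp_neg_sum t).ennreal_ofReal.comp hφ).aemeasurable,
      lintegral_congr_ae ((gammaMeasure_ae_nonneg α 1).mono hinner), lintegral_const_mul _
      (by fun_prop), lintegral_exp_neg_gammaMeasure hα one_pos h1, hdet,
      ← ENNReal.ofReal_mul (Real.rpow_nonneg hQpos.det_pos.le _), ← Real.rpow_add hQpos.det_pos,
      ← ENNReal.ofReal_mul (Real.rpow_nonneg hQpos.det_pos.le _),
      Real.mul_rpow hQpos.det_pos.le h1.le, one_div (1 + h), Real.inv_rpow h1.le,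
      ← Real.rpow_neg h1.le]
    congr 3
    ring

lemma isMultivariateGamma_dirac {α : ℝ} {R : Matrix ι ι ℝ} (h : α = 0 ∨ R = 0) :
    IsMultivariateGamma α R (Measure.dirac 0) where
  isProbabilityMeasure := inferInstance
  nonneg := by simp [ae_dirac_eq]
  laplace t _ := by
    rw [integral_dirac]
    rcases h with rfl | rfl <;> simp

/-- Existence of `Γ(α, BᵀB)` for a matrix `B` with `m` rows as soon as `α` lies in the Gindikin set
of `m × m` matrices. The value `α = 0`, where the law is the point mass at `0`, is included because
the induction lowers `α` by `1/2` at each step. -/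
theorem exists_isMultivariateGamma_gram (m : ℕ) : ∀ (α : ℝ),
    ((∃ k : ℕ, 2 * α = k) ∨ (m : ℝ) - 1 < 2 * α) → ∀ B : Matrix (Fin m) ι ℝ,
      ∃ μ, IsMultivariateGamma α (Bᵀ * B) μ := by
  induction m with
  | zero => exact fun α _ B => ⟨_, isMultivariateGamma_dirac (Or.inr (by ext; simp [mul_apply]))⟩
  | succ m ih =>
    intro α h B
    rcases eq_or_ne α 0 with rfl | hne
    · exact ⟨_, isMultivariateGamma_dirac (Or.inl rfl)⟩
    have hα : 0 < α := by
      rcases h with ⟨k, hk⟩ | h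
      · have : (0 : ℝ) ≤ k := k.cast_nonneg
        exact lt_of_le_of_ne (by linarith) hne.symm
      · push_cast at h
        have : (0 : ℝ) ≤ m := m.cast_nonneg
        linarith
    have h' : (∃ k : ℕ, 2 * (α - 1 / 2) = k) ∨ (m : ℝ) - 1 < 2 * (α - 1 / 2) := by
      rcases h with ⟨k, hk⟩ | h
      · have hk0 : k ≠ 0 := by rintro rfl; simp at hk; exact hne hk
        obtain ⟨l, rfl⟩ := Nat.exists_eq_succ_of_ne_zero hk0
        exact Or.inl ⟨l, by push_cast at hk; linarith⟩
      · push_cast at h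
        exact Or.inr (by linarith)
    obtain ⟨κ, hκ⟩ := ih _ h' (B.submatrix Fin.succ id)
    obtain ⟨μ, hμ⟩ := exists_isMultivariateGamma_add_vecMulVec hα _ (B 0) hκ
    refine ⟨μ, ?_⟩
    convert hμ using 1
    ext i j
    simp [mul_apply, Fin.sum_univ_succ, vecMulVec_apply, add_comm]

/-! ### Poisson mixtures of gamma laws and existence -/

lemma prod_tsum_fin (n : ℕ) (f : Fin n → ℕ → ℝ≥0∞) :
    ∏ i, ∑' j, f i j = ∑' k : Fin n → ℕ, ∏ i, f i (k i) := by
  induction n with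
  | zero => simp
  | succ n ih =>
    rw [Fin.prod_univ_succ, ih, ← (Fin.consEquiv fun _ => ℕ).tsum_eq, ENNReal.tsum_prod',
      ← ENNReal.tsum_mul_right]
    refine tsum_congr fun j => ?_
    rw [← ENNReal.tsum_mul_left]
    exact tsum_congr fun k => by simp [Fin.consEquiv, Fin.prod_univ_succ]

omit [DecidableEq ι] in
/-- Distributivity of a finite product over infinite sums. -/
lemma prod_tsum (f : ι → ℕ → ℝ≥0∞) :
    ∏ i, ∑' j, f i j = ∑' k : ι → ℕ, ∏ i, f i (k i) := by
  let e := Fintype.equivFin ι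
  rw [← e.symm.prod_comp, prod_tsum_fin, ← (e.arrowCongr (Equiv.refl ℕ)).tsum_eq]
  refine tsum_congr fun k => ?_
  rw [← e.symm.prod_comp]
  simp [Equiv.arrowCongr]

lemma tsum_poisson_mul_pow {z q : ℝ} (hz : 0 ≤ z) (hq : 0 ≤ q) :
    ∑' j : ℕ, ENNReal.ofReal (Real.exp (-z) * z ^ j / j.factorial) * ENNReal.ofReal (q ^ j) =
      ENNReal.ofReal (Real.exp (-(z * (1 - q)))) := by
  have hs : HasSum (fun j : ℕ => Real.exp (-z) * z ^ j / j.factorial * q ^ j)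
      (Real.exp (-z) * Real.exp (z * q)) := by
    have := NormedSpace.expSeries_div_hasSum_exp (z * q)
    rw [← Real.exp_eq_exp_ℝ] at this
    refine (this.mul_left (Real.exp (-z))).congr_fun fun j => ?_
    rw [mul_pow]; ring
  have hnn : ∀ j : ℕ, 0 ≤ Real.exp (-z) * z ^ j / j.factorial * q ^ j := fun j => by positivity
  have h : ∀ j : ℕ, ENNReal.ofReal (Real.exp (-z) * z ^ j / j.factorial) * ENNReal.ofReal (q ^ j) =
      ENNReal.ofReal (Real.exp (-z) * z ^ j / j.factorial * q ^ j) := fun j =>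
    (ENNReal.ofReal_mul (by positivity)).symm
  simp_rw [h]
  rw [← ENNReal.ofReal_tsum_of_nonneg hnn hs.summable, hs.tsum_eq, ← Real.exp_add]
  congr 2; ring

lemma det_one_add_smul_one_add_mul_diagonal (c : ℝ) (A : Matrix ι ι ℝ) {t : ι → ℝ}
    (ht : ∀ i, 1 + c * t i ≠ 0) :
    (1 + (c • 1 + A) * diagonal t).det =
      (1 + A * diagonal fun i => t i / (1 + c * t i)).det * ∏ i, (1 + c * t i) := by
  rw [← det_diagonal, ← det_mul]
  congr 1
  rw [add_mul (1 : Matrix ι ι ℝ), Matrix.mul_assoc, diagonal_mul_diagonal, one_mul, add_mul,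
    ← add_assoc]
  congr 1
  · ext i j; by_cases h : i = j <;> simp [h, one_apply]
  · congr 2; ext i; rw [div_mul_cancel₀ _ (ht i)]

/-- If `Γ(α, A)` exists then so does `Γ(α, c I + A)`: given `y` with law `Γ(α, A)`, its
coordinates are independent noncentral gamma variables with noncentrality parameters `yᵢ`, that
is, Poisson mixtures of the gamma laws with shapes `α + kᵢ`. The term `k = 0` of the mixture
bounds the law from below by a multiple of a product of gamma laws. -/
lemma exists_isMultivariateGamma_smul_one_add {α c : ℝ} (hα : 0 < α) (hc : 0 < c)
    {A : Matrix ι ι ℝ} (hA : A.PosSemidef) {κ : Measure (ι → ℝ)}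
    (hκ : IsMultivariateGamma α A κ) :
    ∃ μ, IsMultivariateGamma α (c • 1 + A) μ ∧
      ENNReal.ofReal ((1 + c⁻¹ • A).det ^ (-α)) • gammaProduct (fun _ => α) c⁻¹ ≤ μ := by
  have hc' : 0 < c⁻¹ := inv_pos.mpr hc
  have hsh : ∀ (k : ι → ℕ) i, 0 < α + k i := fun k i => by positivity
  let p : (ι → ℕ) → (ι → ℝ) → ℝ≥0∞ := fun k y =>
    ∏ i, ENNReal.ofReal (Real.exp (-(y i / c)) * (y i / c) ^ k i / (k i).factorial)
  have hp : ∀ k, Measurable (p k) := fun k => by unfold p; fun_prop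
  let μ : Measure (ι → ℝ) := Measure.sum fun k : ι → ℕ =>
    (∫⁻ y, p k y ∂κ) • gammaProduct (fun i => α + k i) c⁻¹
  refine ⟨μ, isMultivariateGamma_of_lintegral ((PosSemidef.one.smul hc.le).add hA) ?_ ?_, ?_⟩
  · rw [Measure.ae_sum_iff]
    exact fun k => Measure.ae_smul_measure (gammaProduct_ae_nonneg (hsh k) hc') _
  · intro t ht
    have hpos : ∀ i, 0 < 1 + c * t i := fun i => by have := ht i; positivity
    let q : ι → ℝ := fun i => (1 + c * t i)⁻¹
    have hq : ∀ i, 0 < q i := fun i => inv_pos.mpr (hpos i)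
    have hterm : ∀ k : ι → ℕ, ∏ i, (c⁻¹ / (c⁻¹ + t i)) ^ (α + k i) =
        (∏ i, q i ^ α) * ∏ i, q i ^ k i := by
      intro k
      rw [← Finset.prod_mul_distrib]
      refine Finset.prod_congr rfl fun i _ => ?_
      have : c⁻¹ / (c⁻¹ + t i) = q i := by
        have := hpos i; simp only [q]; field_simp
      rw [this, Real.rpow_add (hq i), Real.rpow_natCast]
    have hqα : 0 ≤ ∏ i, q i ^ α := Finset.prod_nonneg fun i _ => Real.rpow_nonneg (hq i).le _
    have hmix : ∀ y : ι → ℝ, (∀ i, 0 ≤ y i) →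
        ∑' k : ι → ℕ, p k y * ENNReal.ofReal (∏ i, q i ^ k i) =
          ENNReal.ofReal (Real.exp (-∑ i, t i / (1 + c * t i) * y i)) := by
      intro y hy
      have h1 : ∀ k : ι → ℕ, p k y * ENNReal.ofReal (∏ i, q i ^ k i) =
          ∏ i, (ENNReal.ofReal (Real.exp (-(y i / c)) * (y i / c) ^ k i / (k i).factorial) *
            ENNReal.ofReal (q i ^ k i)) := by
        intro k
        rw [ENNReal.ofReal_prod_of_nonneg fun i _ => pow_nonneg (hq i).le _,
          ← Finset.prod_mul_distrib]
      simp_rw [h1]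
      rw [← prod_tsum (fun i j => ENNReal.ofReal
        (Real.exp (-(y i / c)) * (y i / c) ^ j / j.factorial) * ENNReal.ofReal (q i ^ j)),
        ← Finset.sum_neg_distrib, Real.exp_sum,
        ENNReal.ofReal_prod_of_nonneg fun i _ => Real.exp_nonneg _]
      refine Finset.prod_congr rfl fun i _ => ?_
      rw [tsum_poisson_mul_pow (div_nonneg (hy i) hc.le) (hq i).le]
      congr 3
      have := hpos i
      simp only [q]
      field_simp
      ring
    have hs : ∀ i, 0 ≤ t i / (1 + c * t i) := fun i => div_nonneg (ht i) (hpos i).le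
    rw [lintegral_sum_measure]
    calc ∑' k : ι → ℕ, ∫⁻ x, ENNReal.ofReal (Real.exp (-∑ i, t i * x i))
            ∂((∫⁻ y, p k y ∂κ) • gammaProduct (fun i => α + k i) c⁻¹)
        = ∑' k : ι → ℕ, ENNReal.ofReal (∏ i, q i ^ α) *
            ∫⁻ y, p k y * ENNReal.ofReal (∏ i, q i ^ k i) ∂κ := by
          refine tsum_congr fun k => ?_
          rw [lintegral_smul_measure, lintegral_exp_neg_gammaProduct (hsh k) hc' ht, hterm,
            ENNReal.ofReal_mul hqα, smul_eq_mul, lintegral_mul_const _ (hp k)]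
          ring
      _ = ENNReal.ofReal (∏ i, q i ^ α) *
            ∫⁻ y, ∑' k : ι → ℕ, p k y * ENNReal.ofReal (∏ i, q i ^ k i) ∂κ := by
          rw [ENNReal.tsum_mul_left, lintegral_tsum fun k => ((hp k).mul_const _).aemeasurable]
      _ = ENNReal.ofReal (∏ i, q i ^ α) *
            ENNReal.ofReal ((1 + A * diagonal fun i => t i / (1 + c * t i)).det ^ (-α)) := by
          rw [lintegral_congr_ae (hκ.nonneg.mono hmix), lintegral_exp_neg hκ hs]
      _ = _ := by
          rw [← ENNReal.ofReal_mul hqα,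
            det_one_add_smul_one_add_mul_diagonal c A fun i => (hpos i).ne',
            Real.mul_rpow (det_one_add_mul_diagonal_pos hA hs).le
              (Finset.prod_nonneg fun i _ => (hpos i).le),
            ← Real.finsetProd_rpow _ _ fun i _ => (hpos i).le, mul_comm,
            Finset.prod_congr rfl fun i _ => ?_]
          rw [Real.inv_rpow (hpos i).le, Real.rpow_neg (hpos i).le]
  · have h0 : ∫⁻ y, p 0 y ∂κ = ENNReal.ofReal ((1 + c⁻¹ • A).det ^ (-α)) := by
      have h1 : ∀ y, p 0 y = ENNReal.ofReal (Real.exp (-∑ i, c⁻¹ * y i)) := by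
        intro y
        rw [← Finset.sum_neg_distrib, Real.exp_sum,
          ENNReal.ofReal_prod_of_nonneg fun i _ => Real.exp_nonneg _]
        refine Finset.prod_congr rfl fun i _ => ?_
        simp [div_eq_inv_mul]
      simp_rw [h1]
      rw [lintegral_exp_neg hκ (t := fun _ => c⁻¹) fun _ => hc'.le, ← smul_one_eq_diagonal,
        mul_smul_comm, mul_one]
    have := Measure.le_sum (fun k : ι → ℕ =>
      (∫⁻ y, p k y ∂κ) • gammaProduct (fun i => α + k i) c⁻¹) 0
    simpa [h0] using this

/-- Existence of `Γ(α, R)` for a non-singular `R`. Splitting off the smallest eigenvalue leaves a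
Gram matrix of dimension `card ι - 1`, which is why `2α > card ι - 2` suffices. -/
theorem exists_isMultivariateGamma [Nonempty ι] {R : Matrix ι ι ℝ} (hR : R.PosDef) {α : ℝ}
    (hα : 0 < α) (h : (∃ k : ℕ, 2 * α = k) ∨ (Fintype.card ι : ℝ) - 2 < 2 * α) :
    ∃ μ, IsMultivariateGamma α R μ := by
  obtain ⟨n, hn⟩ := Nat.exists_eq_succ_of_ne_zero (Fintype.card_pos (α := ι)).ne'
  obtain ⟨c, hc, B, rfl⟩ := exists_eq_smul_one_add_gram hn hR
  have h' : (∃ k : ℕ, 2 * α = k) ∨ (n : ℝ) - 1 < 2 * α := by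
    refine h.imp_right fun h => ?_
    rw [hn] at h
    push_cast at h
    linarith
  obtain ⟨κ, hκ⟩ := exists_isMultivariateGamma_gram n α h' B
  obtain ⟨μ, hμ, -⟩ := exists_isMultivariateGamma_smul_one_add hα hc
    (posSemidef_transpose_mul_self B) hκ
  exact ⟨μ, hμ⟩

/-- For `2α` a natural number or `2α > card ι - 1`, the law `Γ(α, c I + A)` dominates a
multiple of a product of gamma laws. The factor depends on `A` only through `|c I + A|`. -/
lemma exists_isMultivariateGamma_ge {α c : ℝ} (hα : 0 < α) (hc : 0 < c)
    (h : (∃ k : ℕ, 2 * α = k) ∨ (Fintype.card ι : ℝ) - 1 < 2 * α)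
    {A : Matrix ι ι ℝ} (hA : A.PosSemidef) :
    ∃ μ, IsMultivariateGamma α (c • 1 + A) μ ∧
      ENNReal.ofReal ((1 + c⁻¹ • A).det ^ (-α)) • gammaProduct (fun _ => α) c⁻¹ ≤ μ := by
  obtain ⟨C, rfl⟩ := exists_eq_transpose_mul_self hA
  let e := (Fintype.equivFin ι).symm
  obtain ⟨κ, hκ⟩ := exists_isMultivariateGamma_gram _ α h (C.submatrix e id)
  refine exists_isMultivariateGamma_smul_one_add hα hc hA (κ := κ) ?_
  convert hκ using 1
  ext i j
  simp [mul_apply, e.sum_comp (fun k => C k i * C k j)]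

open Filter Topology Polynomial

/-! ### Polynomials approximating a step function -/

/-- The polynomial `1 - (1 - u ^ M) ^ b` with `b = ⌈M / c ^ M⌉` and `M = N + 1`. On `[0, 1]` it
increases from `0` to `1` when `c > 0`. For `c ≤ u` one has `(1 - u ^ M) ^ b ≤ exp (-M)`,
while Bernoulli's inequality bounds the polynomial by `M (u / c) ^ M + u ^ M` for `u < c`. -/
noncomputable def stepPolynomial (c : ℝ) (N : ℕ) : ℝ[X] :=
  1 - (1 - X ^ (N + 1)) ^ ⌈((N + 1 : ℕ) : ℝ) / c ^ (N + 1)⌉₊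

lemma eval_stepPolynomial (c : ℝ) (N : ℕ) (u : ℝ) : (stepPolynomial c N).eval u =
    1 - (1 - u ^ (N + 1)) ^ ⌈((N + 1 : ℕ) : ℝ) / c ^ (N + 1)⌉₊ := by
  simp [stepPolynomial]

lemma eval_stepPolynomial_mem_Icc (c : ℝ) (N : ℕ) {u : ℝ} (h0 : 0 ≤ u) (h1 : u ≤ 1) :
    (stepPolynomial c N).eval u ∈ Set.Icc 0 1 := by
  rw [eval_stepPolynomial]
  have h2 : 0 ≤ 1 - u ^ (N + 1) := sub_nonneg.mpr (pow_le_one₀ h0 h1)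
  have h3 : 1 - u ^ (N + 1) ≤ 1 := sub_le_self _ (pow_nonneg h0 _)
  exact ⟨sub_nonneg.mpr (pow_le_one₀ h2 h3), sub_le_self _ (pow_nonneg h2 _)⟩

lemma eval_stepPolynomial_mono (c : ℝ) (N : ℕ) {u v : ℝ} (h0 : 0 ≤ u) (huv : u ≤ v) (h1 : v ≤ 1) :
    (stepPolynomial c N).eval u ≤ (stepPolynomial c N).eval v := by
  rw [eval_stepPolynomial, eval_stepPolynomial]
  have h2 : 0 ≤ 1 - v ^ (N + 1) := sub_nonneg.mpr (pow_le_one₀ (h0.trans huv) h1)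
  gcongr

lemma eval_derivative_stepPolynomial_nonneg (c : ℝ) (N : ℕ) {u : ℝ} (h0 : 0 ≤ u) (h1 : u ≤ 1) :
    0 ≤ (derivative (stepPolynomial c N)).eval u := by
  have h2 : 0 ≤ 1 - u ^ (N + 1) := sub_nonneg.mpr (pow_le_one₀ h0 h1)
  simp only [stepPolynomial, derivative_sub, derivative_one, derivative_pow, derivative_X,
    eval_sub, eval_mul, eval_pow, eval_X, eval_one, zero_sub, mul_one, mul_neg, neg_neg,
    eval_natCast, map_natCast, Nat.add_sub_cancel]
  positivity

lemma tendsto_eval_stepPolynomial {c u : ℝ} (hc : 0 < c) (hc1 : c ≤ 1) (h0 : 0 ≤ u) (h1 : u ≤ 1) :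
    Tendsto (fun N => (stepPolynomial c N).eval u) atTop (𝓝 (if c ≤ u then 1 else 0)) := by
  have hb : ∀ N : ℕ, ((N + 1 : ℕ) : ℝ) / c ^ (N + 1) ≤
      (⌈((N + 1 : ℕ) : ℝ) / c ^ (N + 1)⌉₊ : ℝ) := fun N => Nat.le_ceil _
  have hb' : ∀ N : ℕ, (⌈((N + 1 : ℕ) : ℝ) / c ^ (N + 1)⌉₊ : ℝ) ≤
      ((N + 1 : ℕ) : ℝ) / c ^ (N + 1) + 1 := fun N => (Nat.ceil_lt_add_one (by positivity)).le
  have hnn : ∀ N : ℕ, 0 ≤ 1 - u ^ (N + 1) := fun N => sub_nonneg.mpr (pow_le_one₀ h0 h1)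
  split_ifs with hcu
  · have hlim : Tendsto (fun N : ℕ => 1 - Real.exp (-((N + 1 : ℕ) : ℝ))) atTop (𝓝 1) := by
      have := (Real.tendsto_exp_neg_atTop_nhds_zero.comp
        (tendsto_natCast_atTop_atTop.comp (tendsto_add_atTop_nat 1))).const_sub 1
      simpa [Function.comp_def] using this
    refine tendsto_of_tendsto_of_tendsto_of_le_of_le hlim tendsto_const_nhds (fun N => ?_)
      (fun N => (eval_stepPolynomial_mem_Icc c N h0 h1).2)
    simp only [eval_stepPolynomial]
    set b := ⌈((N + 1 : ℕ) : ℝ) / c ^ (N + 1)⌉₊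
    have h2 : (1 - u ^ (N + 1)) ^ b ≤ Real.exp (-(u ^ (N + 1))) ^ b :=
      pow_le_pow_left₀ (hnn N) (Real.one_sub_le_exp_neg _) _
    have h3 : ((N + 1 : ℕ) : ℝ) ≤ b * u ^ (N + 1) := by
      calc ((N + 1 : ℕ) : ℝ) = ((N + 1 : ℕ) : ℝ) / c ^ (N + 1) * c ^ (N + 1) := by
            field_simp
        _ ≤ b * u ^ (N + 1) := by
            gcongr
            exact hb N
    rw [← Real.exp_nat_mul] at h2
    have h4 : Real.exp (b * -(u ^ (N + 1))) ≤ Real.exp (-((N + 1 : ℕ) : ℝ)) := by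
      rw [Real.exp_le_exp]; linarith
    linarith
  · have hlt : u < c := not_le.mp hcu
    have hu1 : |u / c| < 1 := by
      rw [abs_of_nonneg (by positivity), div_lt_one hc]; exact hlt
    have hlim : Tendsto (fun N : ℕ => ((N + 1 : ℕ) : ℝ) * (u / c) ^ (N + 1) + u ^ (N + 1)) atTop
        (𝓝 0) := by
      have h1 := (tendsto_self_mul_const_pow_of_lt_one (by positivity : 0 ≤ u / c)
        ((le_abs_self _).trans_lt hu1)).comp (tendsto_add_atTop_nat 1)
      have h2 := (tendsto_pow_atTop_nhds_zero_of_lt_one h0 (hlt.trans_le hc1)).comp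
        (tendsto_add_atTop_nat 1)
      simpa [Function.comp_def] using h1.add h2
    refine tendsto_of_tendsto_of_tendsto_of_le_of_le tendsto_const_nhds hlim
      (fun N => (eval_stepPolynomial_mem_Icc c N h0 h1).1) (fun N => ?_)
    simp only [eval_stepPolynomial]
    set b := ⌈((N + 1 : ℕ) : ℝ) / c ^ (N + 1)⌉₊
    have h2 : 1 + (b : ℝ) * (-(u ^ (N + 1))) ≤ (1 + -(u ^ (N + 1))) ^ b :=
      one_add_mul_le_pow (by linarith [hnn N]) b
    have h3 : (b : ℝ) * u ^ (N + 1) ≤ (((N + 1 : ℕ) : ℝ) / c ^ (N + 1) + 1) * u ^ (N + 1) := by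
      gcongr
      exact hb' N
    have h4 : (((N + 1 : ℕ) : ℝ) / c ^ (N + 1) + 1) * u ^ (N + 1) =
        ((N + 1 : ℕ) : ℝ) * (u / c) ^ (N + 1) + u ^ (N + 1) := by
      rw [div_pow]; ring
    rw [← sub_eq_add_neg] at h2
    linarith

/-- As functions of `exp (-y)`, the step polynomials at `exp (-x)` and their images under the Euler
operator have gamma integrals bounded away from zero: the former are close to `1` on `[0, x]`, the
latter concentrate unit mass near `x`, where the density is positive. -/
lemma eventually_le_integral_stepPolynomial {a r x : ℝ} (ha : 0 < a) (hr : 0 < r) (hx : 0 < x) :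
    ∃ δ > 0, ∀ᶠ N in atTop,
      δ ≤ ∫ y, (stepPolynomial (Real.exp (-x)) N).eval (Real.exp (-y)) ∂gammaMeasure a r ∧
      δ ≤ ∫ y, (X * derivative (stepPolynomial (Real.exp (-x)) N)).eval (Real.exp (-y))
        ∂gammaMeasure a r := by
  have := isProbabilityMeasure_gammaMeasure ha hr
  have hcont : ContinuousOn (gammaPDFReal a r) (Set.Icc (x / 2) (x + 1)) := by
    have : ContinuousOn (fun y : ℝ => r ^ a / Real.Gamma a * y ^ (a - 1) * Real.exp (-(r * y)))
        (Set.Icc (x / 2) (x + 1)) := by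
      refine ContinuousOn.mul (ContinuousOn.mul continuousOn_const ?_) (by fun_prop)
      exact continuousOn_id.rpow_const fun y hy => Or.inl ((half_pos hx).trans_le hy.1).ne'
    refine this.congr fun y hy => ?_
    rw [gammaPDFReal, if_pos ((half_pos hx).le.trans hy.1)]
  obtain ⟨y₀, hy₀, hmin⟩ := isCompact_Icc.exists_isMinOn
    (Set.nonempty_Icc.mpr (by linarith : x / 2 ≤ x + 1)) hcont
  set m := gammaPDFReal a r y₀ with hm_def
  have hm : 0 < m := gammaPDFReal_pos ha hr ((half_pos hx).trans_le hy₀.1)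
  have hdom : ENNReal.ofReal m • volume.restrict (Set.Ioc (x / 2) (x + 1)) ≤ gammaMeasure a r := by
    rw [← withDensity_const, ← withDensity_indicator measurableSet_Ioc, gammaMeasure]
    refine withDensity_mono (Eventually.of_forall fun y => ?_)
    by_cases hy : y ∈ Set.Ioc (x / 2) (x + 1)
    · rw [Set.indicator_of_mem hy]
      exact ENNReal.ofReal_le_ofReal (hmin (Set.Ioc_subset_Icc_self hy))
    · rw [Set.indicator_of_notMem hy]; exact zero_le
  -- On `[x / 2, x + 1]` the gamma density is at least `m`.
  have key : ∀ Q : ℝ[X], (∀ u, 0 ≤ u → u ≤ 1 → 0 ≤ Q.eval u) →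
      m * ∫ y in (x / 2)..(x + 1), Q.eval (Real.exp (-y)) ≤
        ∫ y, Q.eval (Real.exp (-y)) ∂gammaMeasure a r := by
    intro Q hQ
    have hcontQ : Continuous fun y : ℝ => Q.eval (Real.exp (-y)) := by fun_prop
    obtain ⟨C, hC⟩ := isCompact_Icc.exists_bound_of_continuousOn
      (s := Set.Icc (0 : ℝ) 1) (f := fun u => Q.eval u) Q.continuous.continuousOn
    have hint : Integrable (fun y : ℝ => Q.eval (Real.exp (-y))) (gammaMeasure a r) := by
      refine Integrable.of_bound (C := C) hcontQ.aestronglyMeasurable ?_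
      filter_upwards [gammaMeasure_ae_nonneg a r] with y hy
      exact hC _ ⟨Real.exp_nonneg _, Real.exp_le_one_iff.mpr (by linarith)⟩
    have hnn : 0 ≤ᵐ[gammaMeasure a r] fun y : ℝ => Q.eval (Real.exp (-y)) := by
      filter_upwards [gammaMeasure_ae_nonneg a r] with y hy
      exact hQ _ (Real.exp_nonneg _) (Real.exp_le_one_iff.mpr (by linarith))
    have := integral_mono_measure hdom hnn hint
    rwa [integral_smul_measure, ENNReal.toReal_ofReal hm.le, smul_eq_mul,
      ← intervalIntegral.integral_of_le (by linarith)] at this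
  have hexp : ∀ {y : ℝ}, 0 ≤ y → Real.exp (-y) ≤ 1 := fun hy =>
    Real.exp_le_one_iff.mpr (by linarith)
  have hlim : ∀ y, 0 ≤ y → Tendsto
      (fun N => (stepPolynomial (Real.exp (-x)) N).eval (Real.exp (-y))) atTop
      (𝓝 (if Real.exp (-x) ≤ Real.exp (-y) then 1 else 0)) := fun y hy =>
    tendsto_eval_stepPolynomial (Real.exp_pos _) (hexp hx.le) (Real.exp_nonneg _) (hexp hy)
  have h1 := hlim x hx.le
  have h2 := hlim (x / 2) (half_pos hx).le
  have h3 := hlim (x + 1) (by linarith)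
  rw [if_pos le_rfl] at h1
  rw [if_pos (Real.exp_le_exp.mpr (by linarith))] at h2
  rw [if_neg (not_le.mpr (Real.exp_lt_exp.mpr (by linarith)))] at h3
  refine ⟨m * min (x / 4) (1 / 2), by positivity, ?_⟩
  filter_upwards [h1.eventually_const_le (by norm_num : (1 / 2 : ℝ) < 1),
    h2.eventually_const_le (by norm_num : (3 / 4 : ℝ) < 1),
    h3.eventually_le_const (by norm_num : (0 : ℝ) < 1 / 4)] with N hN1 hN2 hN3
  set p := stepPolynomial (Real.exp (-x)) N with hp
  have hcontp : Continuous fun y : ℝ => p.eval (Real.exp (-y)) := by fun_prop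
  constructor
  · refine le_trans ?_ (key p fun u h0 h1 => (eval_stepPolynomial_mem_Icc _ N h0 h1).1)
    refine mul_le_mul_of_nonneg_left ((min_le_left _ _).trans ?_) hm.le
    rw [← intervalIntegral.integral_add_adjacent_intervals (b := x)
      (hcontp.intervalIntegrable _ _) (hcontp.intervalIntegrable _ _)]
    have hA : ∫ _ in (x / 2)..x, (1 / 2 : ℝ) ≤ ∫ y in (x / 2)..x, p.eval (Real.exp (-y)) := by
      refine intervalIntegral.integral_mono_on (by linarith) (by simp)
        (hcontp.intervalIntegrable _ _) fun y hy => hN1.trans ?_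
      exact eval_stepPolynomial_mono _ N (Real.exp_nonneg _)
        (Real.exp_le_exp.mpr (by linarith [hy.2])) (hexp (by linarith [hy.1]))
    have hB : 0 ≤ ∫ y in x..(x + 1), p.eval (Real.exp (-y)) :=
      intervalIntegral.integral_nonneg (by linarith) fun y hy =>
        (eval_stepPolynomial_mem_Icc _ N (Real.exp_nonneg _) (hexp (by linarith [hy.1]))).1
    rw [intervalIntegral.integral_const, smul_eq_mul] at hA
    linarith
  · refine le_trans ?_ (key _ fun u h0 h1 => ?_)
    · refine mul_le_mul_of_nonneg_left ((min_le_right _ _).trans ?_) hm.le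
      have hderiv : ∀ y, HasDerivAt (fun y : ℝ => -p.eval (Real.exp (-y)))
          ((X * derivative p).eval (Real.exp (-y))) y := by
        intro y
        have := ((p.hasDerivAt (Real.exp (-y))).comp y (hasDerivAt_neg y).exp).neg
        exact this.congr_deriv (by rw [eval_mul, eval_X]; ring)
      rw [intervalIntegral.integral_eq_sub_of_hasDerivAt (fun y _ => hderiv y)
        (Continuous.intervalIntegrable (by fun_prop) _ _)]
      linarith
    · rw [eval_mul, eval_X]
      exact mul_nonneg h0 (eval_derivative_stepPolynomial_nonneg _ N h0 h1)

/-! ### Test functions and the derivative of their integrals -/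

/-- The product test function `y ↦ ∏ Pᵢ(exp (-yᵢ))`. -/
noncomputable def testFun (P : ι → ℝ[X]) (y : ι → ℝ) : ℝ := ∏ i, (P i).eval (Real.exp (-y i))

omit [DecidableEq ι] in
lemma continuous_testFun (P : ι → ℝ[X]) : Continuous (testFun P) := by
  unfold testFun; fun_prop

lemma exp_neg_mem_Icc {y : ℝ} (hy : 0 ≤ y) : Real.exp (-y) ∈ Set.Icc (0 : ℝ) 1 :=
  ⟨Real.exp_nonneg _, Real.exp_le_one_iff.mpr (by linarith)⟩

omit [DecidableEq ι] in
lemma integrable_testFun (P : ι → ℝ[X]) {μ : Measure (ι → ℝ)} [IsFiniteMeasure μ]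
    (hμ : ∀ᵐ y ∂μ, ∀ i, 0 ≤ y i) : Integrable (testFun P) μ := by
  have h : ∀ i, ∃ C, ∀ u ∈ Set.Icc (0 : ℝ) 1, ‖(P i).eval u‖ ≤ C := fun i =>
    isCompact_Icc.exists_bound_of_continuousOn (P i).continuous.continuousOn
  choose C hC using h
  refine Integrable.of_bound (C := ∏ i, C i) (continuous_testFun P).aestronglyMeasurable ?_
  filter_upwards [hμ] with y hy
  rw [testFun, norm_prod]
  exact Finset.prod_le_prod (fun _ _ => norm_nonneg _) fun i _ => hC i _ (exp_neg_mem_Icc (hy i))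

/-- The integral of a test function is a finite linear combination of values of the Laplace
transform. -/
lemma integral_testFun {α : ℝ} {R : Matrix ι ι ℝ} {μ : Measure (ι → ℝ)}
    (h : IsMultivariateGamma α R μ) {P : ι → ℝ[X]} {d : ℕ} (hd : ∀ i, (P i).natDegree < d) :
    ∫ y, testFun P y ∂μ = ∑ k ∈ Fintype.piFinset fun _ : ι => Finset.range d,
      (∏ i, (P i).coeff (k i)) * (1 + R * diagonal fun i => (k i : ℝ)).det ^ (-α) := by
  have := h.isProbabilityMeasure
  have hexp : ∀ y : ι → ℝ, testFun P y = ∑ k ∈ Fintype.piFinset fun _ : ι => Finset.range d,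
      (∏ i, (P i).coeff (k i)) * Real.exp (-∑ i, (k i : ℝ) * y i) := by
    intro y
    simp_rw [testFun, fun i => eval_eq_sum_range' (hd i) (Real.exp (-y i))]
    rw [Finset.prod_univ_sum]
    refine Finset.sum_congr rfl fun k _ => ?_
    rw [Finset.prod_mul_distrib, ← Finset.sum_neg_distrib, Real.exp_sum]
    congr 1
    exact Finset.prod_congr rfl fun i _ => by rw [← Real.exp_nat_mul]; congr 1; ring
  simp_rw [hexp]
  rw [integral_finsetSum _ fun k _ =>
    (integrable_exp_neg_sum h.nonneg fun i => Nat.cast_nonneg _).const_mul _]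
  refine Finset.sum_congr rfl fun k _ => ?_
  rw [integral_const_mul, h.laplace _ fun i => Nat.cast_nonneg _]

/-- Apply the Euler operator `u d/du` to the factors with index in `S`. On functions of
`u = exp (-y)` this operator is `-d/dy`. -/
noncomputable def eulerOn (S : Finset ι) (P : ι → ℝ[X]) (i : ι) : ℝ[X] :=
  if i ∈ S then X * derivative (P i) else P i

omit [Fintype ι] in
lemma natDegree_eulerOn_lt (S : Finset ι) {P : ι → ℝ[X]} {d : ℕ} (hd : ∀ i, (P i).natDegree < d)
    (i : ι) : (eulerOn S P i).natDegree < d := by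
  unfold eulerOn
  split_ifs
  · refine lt_of_le_of_lt ?_ (hd i)
    rw [natDegree_le_iff_coeff_eq_zero]
    rintro (_ | n) hn
    · simp at hn
    · rw [coeff_X_mul, coeff_derivative, coeff_eq_zero_of_natDegree_lt hn, zero_mul]
  · exact hd i

lemma prod_coeff_eulerOn (S : Finset ι) (P : ι → ℝ[X]) (k : ι → ℕ) :
    ∏ i, (eulerOn S P i).coeff (k i) = (∏ i ∈ S, (k i : ℝ)) * ∏ i, (P i).coeff (k i) := by
  rw [← Finset.prod_ite_mem_eq S, ← Finset.prod_mul_distrib]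
  refine Finset.prod_congr rfl fun i _ => ?_
  unfold eulerOn
  split_ifs with h
  · rcases k i with _ | n
    · simp
    · rw [coeff_X_mul, coeff_derivative]; push_cast; ring
  · rw [one_mul]

lemma differentiable_det_crossScale (R : Matrix (ι₁ ⊕ ι₂) (ι₁ ⊕ ι₂) ℝ) :
    Differentiable ℝ fun τ => (crossScale τ R).det := by
  simp only [det_apply', crossScale, of_apply]
  have : ∀ i j : ι₁ ⊕ ι₂, Differentiable ℝ fun τ : ℝ =>
      (if i.isLeft = j.isLeft then 1 else τ) * R i j := by
    intro i j; split_ifs <;> fun_prop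
  fun_prop

/-- Derivative in `τ` of the integral of a test function under `Γ(α, R_τ)`, where `R_τ` has
off-diagonal blocks scaled by `τ`. Differentiating `|I + R_τ T| ^ (-α)` raises the shape parameter
to `α + 1` and brings down derivatives of the principal minors, each with a factor `∏_S tᵢ` that
acts on the test function as an Euler operator. -/
lemma hasDerivAt_integral_testFun {α : ℝ} {R : Matrix (ι₁ ⊕ ι₂) (ι₁ ⊕ ι₂) ℝ}
    {P : ι₁ ⊕ ι₂ → ℝ[X]} {d : ℕ} (hd : ∀ i, (P i).natDegree < d) {τ : ℝ}
    (hτ : (crossScale τ R).PosSemidef) {ν : Measure (ι₁ ⊕ ι₂ → ℝ)}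
    (hν : IsMultivariateGamma (α + 1) (crossScale τ R) ν) :
    HasDerivAt (fun σ => ∑ k ∈ Fintype.piFinset fun _ : ι₁ ⊕ ι₂ => Finset.range d,
        (∏ i, (P i).coeff (k i)) *
          (1 + crossScale σ R * diagonal fun i => (k i : ℝ)).det ^ (-α))
      (α * ∑ S : Finset (ι₁ ⊕ ι₂), -deriv (fun σ => (crossScale σ (principalPart S R)).det) τ *
        ∫ y, testFun (eulerOn S P) y ∂ν) τ := by
  have h1 : ∀ k : ι₁ ⊕ ι₂ → ℕ, HasDerivAt
      (fun σ => (1 + crossScale σ R * diagonal fun i => (k i : ℝ)).det)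
      (∑ S : Finset (ι₁ ⊕ ι₂), (∏ i ∈ S, (k i : ℝ)) *
        deriv (fun σ => (crossScale σ (principalPart S R)).det) τ) τ := by
    intro k
    simp_rw [det_one_add_mul_diagonal, principalPart_crossScale]
    exact HasDerivAt.fun_sum fun S _ =>
      ((differentiable_det_crossScale (principalPart S R) τ).hasDerivAt).const_mul _
  have h2 := HasDerivAt.fun_sum (u := Fintype.piFinset fun _ : ι₁ ⊕ ι₂ => Finset.range d)
    fun k _ => (((h1 k).rpow_const (p := -α)
      (Or.inl (det_one_add_mul_diagonal_pos hτ fun i => Nat.cast_nonneg _).ne')).const_mul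
        (∏ i, (P i).coeff (k i)))
  refine h2.congr_deriv ?_
  have hrw : ∀ S : Finset (ι₁ ⊕ ι₂), ∫ y, testFun (eulerOn S P) y ∂ν =
      ∑ k ∈ Fintype.piFinset fun _ : ι₁ ⊕ ι₂ => Finset.range d,
      ((∏ i ∈ S, (k i : ℝ)) * ∏ i, (P i).coeff (k i)) *
        (1 + crossScale τ R * diagonal fun i => (k i : ℝ)).det ^ (-(α + 1)) := by
    intro S
    rw [integral_testFun hν (natDegree_eulerOn_lt S hd)]
    simp_rw [prod_coeff_eulerOn]
  simp_rw [hrw, Finset.sum_mul, Finset.mul_sum]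
  rw [Finset.sum_comm]
  refine Finset.sum_congr rfl fun S _ => Finset.sum_congr rfl fun k _ => ?_
  rw [show -α - 1 = -(α + 1) by ring]
  ring

omit [DecidableEq ι] in
lemma testFun_nonneg {P : ι → ℝ[X]} (hP : ∀ i u, 0 ≤ u → u ≤ 1 → 0 ≤ (P i).eval u) {y : ι → ℝ}
    (hy : ∀ i, 0 ≤ y i) : 0 ≤ testFun P y :=
  Finset.prod_nonneg fun i _ =>
    hP i _ (exp_neg_mem_Icc (hy i)).1 (exp_neg_mem_Icc (hy i)).2

omit [Fintype ι] in
lemma eval_eulerOn_nonneg {P : ι → ℝ[X]} (hP : ∀ i u, 0 ≤ u → u ≤ 1 → 0 ≤ (P i).eval u)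
    (hP' : ∀ i u, 0 ≤ u → u ≤ 1 → 0 ≤ (derivative (P i)).eval u) (S : Finset ι) (i : ι) (u : ℝ)
    (h0 : 0 ≤ u) (h1 : u ≤ 1) : 0 ≤ (eulerOn S P i).eval u := by
  unfold eulerOn
  split_ifs
  · rw [eval_mul, eval_X]
    exact mul_nonneg h0 (hP' i u h0 h1)
  · exact hP i u h0 h1

/-! ### Monotonicity and the strict inequality -/

omit [Fintype ι₁] [DecidableEq ι₁] [Fintype ι₂] [DecidableEq ι₂] in
lemma posDef_toBlocks₁₁ {R : Matrix (ι₁ ⊕ ι₂) (ι₁ ⊕ ι₂) ℝ} (hR : R.PosDef) :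
    R.toBlocks₁₁.PosDef := hR.submatrix Sum.inl_injective

omit [Fintype ι₁] [DecidableEq ι₁] [Fintype ι₂] [DecidableEq ι₂] in
lemma posDef_toBlocks₂₂ {R : Matrix (ι₁ ⊕ ι₂) (ι₁ ⊕ ι₂) ℝ} (hR : R.PosDef) :
    R.toBlocks₂₂.PosDef := hR.submatrix Sum.inr_injective

omit [Fintype ι] in
lemma posDef_smul_one_add {c : ℝ} (hc : 0 < c) {A : Matrix ι ι ℝ} (hA : A.PosSemidef) :
    (c • 1 + A).PosDef := (PosDef.one.smul hc).add_posSemidef hA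

lemma posDef_principalPart (S : Finset ι) {c : ℝ} (hc : 0 < c) {A : Matrix ι ι ℝ}
    (hA : A.PosSemidef) : (principalPart S (c • 1 + A)).PosDef := by
  let P : Matrix ι ι ℝ := diagonal fun i => if i ∈ S then 1 else 0
  have h1 : (P * A * P).PosSemidef := by
    simpa [P] using hA.mul_mul_conjTranspose_same P
  have h2 : principalPart S (c • 1 + A) =
      diagonal (fun i => if i ∈ S then c else 1) + P * A * P := by
    rw [principalPart_eq]
    ext i j
    by_cases hij : i = j
    · subst hij; by_cases hi : i ∈ S <;> simp [hi, P]
    · by_cases hi : i ∈ S <;> simp [hi, hij, P]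
  rw [h2]
  refine PosDef.add_posSemidef (PosDef.diagonal fun i => ?_) h1
  split_ifs
  exacts [hc, one_pos]

lemma deriv_det_crossScale_nonpos {R : Matrix (ι₁ ⊕ ι₂) (ι₁ ⊕ ι₂) ℝ} (hR : R.PosDef) {τ : ℝ}
    (hτ : τ ∈ Set.Ioo (0 : ℝ) 1) : deriv (fun σ => (crossScale σ R).det) τ ≤ 0 := by
  rw [← derivWithin_of_mem_nhds (Icc_mem_nhds hτ.1 hτ.2)]
  exact (antitoneOn_det_crossScale hR.posSemidef (posDef_toBlocks₁₁ hR)).derivWithin_nonpos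

lemma deriv_det_crossScale_principalPart_pair {R : Matrix (ι₁ ⊕ ι₂) (ι₁ ⊕ ι₂) ℝ}
    (hdiag : ∀ i, R i i = 1) (hsymm : R.IsSymm) (i : ι₁) (j : ι₂) (τ : ℝ) :
    deriv (fun σ => (crossScale σ (principalPart {Sum.inl i, Sum.inr j} R)).det) τ =
      -(2 * τ * R (Sum.inl i) (Sum.inr j) ^ 2) := by
  have h : ∀ σ, (crossScale σ (principalPart {Sum.inl i, Sum.inr j} R)).det =
      1 - (σ * R (Sum.inl i) (Sum.inr j)) ^ 2 := by
    intro σ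
    rw [← principalPart_crossScale, det_principalPart_pair (by simp [crossScale, hdiag]) ?_
      (by simp)]
    · simp [crossScale]
    · ext a b
      simp [crossScale, eq_comm, hsymm.apply a b]
  simp_rw [h]
  have := ((((hasDerivAt_id τ).mul_const (R (Sum.inl i) (Sum.inr j))).pow 2).const_sub 1).deriv
  refine this.trans ?_
  simp; ring

omit [DecidableEq ι] in
lemma integral_testFun_gammaProduct {a r : ℝ} (ha : 0 < a) (hr : 0 < r) (P : ι → ℝ[X]) :
    ∫ y, testFun P y ∂gammaProduct (fun _ => a) r =
      ∏ i, ∫ y, (P i).eval (Real.exp (-y)) ∂gammaMeasure a r := by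
  have := isProbabilityMeasure_gammaMeasure ha hr
  exact integral_fintype_prod_eq_prod fun i y => (P i).eval (Real.exp (-y))

/-- Integrals of products of nonnegative increasing polynomials in `exp (-yᵢ)` are larger under
`Γ(α, R)` than under `Γ(α, R₀)`. The lower bound for the difference comes from the single minor of a
nonzero cross-correlation; its constant does not depend on the polynomials. -/
lemma exists_le_integral_testFun_sub {α : ℝ} (hα : 0 < α)
    {R : Matrix (ι₁ ⊕ ι₂) (ι₁ ⊕ ι₂) ℝ} (hR : R.PosDef) (hdiag : ∀ i, R i i = 1)
    (h : (∃ k : ℕ, 2 * α = k) ∨ (Fintype.card (ι₁ ⊕ ι₂) : ℝ) - 2 < 2 * α)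
    {i : ι₁} {j : ι₂} (hij : R (Sum.inl i) (Sum.inr j) ≠ 0) :
    ∃ C > 0, ∃ r > 0, ∀ P : ι₁ ⊕ ι₂ → ℝ[X], (∀ s u, 0 ≤ u → u ≤ 1 → 0 ≤ (P s).eval u) →
      (∀ s u, 0 ≤ u → u ≤ 1 → 0 ≤ (derivative (P s)).eval u) →
      ∀ μ μ₀ : Measure (ι₁ ⊕ ι₂ → ℝ), IsMultivariateGamma α R μ →
        IsMultivariateGamma α (crossScale 0 R) μ₀ →
        C * ∏ s, ∫ y, (eulerOn {Sum.inl i, Sum.inr j} P s).eval (Real.exp (-y))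
            ∂gammaMeasure (α + 1) r ≤
          ∫ y, testFun P y ∂μ - ∫ y, testFun P y ∂μ₀ := by
  have hsymm : R.IsSymm := by
    have := hR.1
    rwa [IsHermitian, conjTranspose_eq_transpose_of_trivial] at this
  have hne : Nonempty (ι₁ ⊕ ι₂) := ⟨Sum.inl i⟩
  obtain ⟨n, hn⟩ := Nat.exists_eq_succ_of_ne_zero (Fintype.card_pos (α := ι₁ ⊕ ι₂)).ne'
  obtain ⟨c, hc, B, hRc⟩ := exists_eq_smul_one_add_gram hn hR
  set A := Bᵀ * B with hA_def
  have hA : A.PosSemidef := posSemidef_transpose_mul_self B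
  have hα1 : 0 < α + 1 := by linarith
  have hc' : 0 < c⁻¹ := inv_pos.mpr hc
  have h' : (∃ k : ℕ, 2 * (α + 1) = k) ∨
      (Fintype.card (ι₁ ⊕ ι₂) : ℝ) - 1 < 2 * (α + 1) := by
    rcases h with ⟨k, hk⟩ | h
    · exact Or.inl ⟨k + 2, by push_cast; linarith⟩
    · exact Or.inr (by linarith)
  set M : Matrix (ι₁ ⊕ ι₂) (ι₁ ⊕ ι₂) ℝ := (1 : ℝ) • 1 + c⁻¹ • A with hM
  have hMpos : M.PosDef := posDef_smul_one_add one_pos (hA.smul hc'.le)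
  have hMτ : ∀ τ, crossScale τ M = 1 + c⁻¹ • crossScale τ A := by
    intro τ
    rw [hM, crossScale_smul_one_add, one_smul]
    congr 1
    ext a b; simp [crossScale, mul_left_comm]
  have hMdet : ∀ τ ∈ Set.Icc (0 : ℝ) 1, 0 < (crossScale τ M).det := by
    intro τ hτ
    have := posDef_smul_one_add one_pos ((posSemidef_crossScale hA hτ.1 hτ.2).smul hc'.le)
    rw [hMτ]
    simpa using this.det_pos
  -- the constant is uniform in `τ` since `|M_τ| ≤ |M_0|`
  set W := (crossScale 0 M).det ^ (-(α + 1)) with hW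
  have hWpos : 0 < W := Real.rpow_pos_of_pos (hMdet 0 (by simp)) _
  set r := R (Sum.inl i) (Sum.inr j) with hr_def
  have hr2 : 0 < r ^ 2 := by positivity
  have hRτ : ∀ τ, crossScale τ R = c • 1 + crossScale τ A := fun τ => by
    rw [hRc, crossScale_smul_one_add]
  refine ⟨α * r ^ 2 * W, by positivity, c⁻¹, hc', ?_⟩
  intro P hP hP' μ μ₀ hμ hμ₀
  obtain ⟨d, hd⟩ : ∃ d, ∀ s, (P s).natDegree < d :=
    ⟨∑ s, (P s).natDegree + 1, fun s => Nat.lt_succ_of_le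
      (Finset.single_le_sum (f := fun s => (P s).natDegree) (fun _ _ => Nat.zero_le _)
        (Finset.mem_univ s))⟩
  set G : ℝ → ℝ := fun σ => ∑ k ∈ Fintype.piFinset fun _ : ι₁ ⊕ ι₂ => Finset.range d,
        (∏ i, (P i).coeff (k i)) *
          (1 + crossScale σ R * diagonal fun i => (k i : ℝ)).det ^ (-α) with hG
  have hG1 : ∫ y, testFun P y ∂μ = G 1 := by
    rw [integral_testFun hμ hd, hG]; simp only [crossScale_one]
  have hG0 : ∫ y, testFun P y ∂μ₀ = G 0 := by rw [integral_testFun hμ₀ hd]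
  set S₀ : Finset (ι₁ ⊕ ι₂) := {Sum.inl i, Sum.inr j} with hS₀
  set I := ∏ s, ∫ y, (eulerOn S₀ P s).eval (Real.exp (-y)) ∂gammaMeasure (α + 1) c⁻¹ with hI
  have hderiv : ∀ τ ∈ Set.Icc (0 : ℝ) 1, ∃ g', HasDerivAt G g' τ ∧
      (τ ∈ Set.Ioo (0 : ℝ) 1 → 2 * τ * (α * r ^ 2 * W * I) ≤ g') := by
    intro τ hτ
    have hAτ := posSemidef_crossScale hA hτ.1 hτ.2
    obtain ⟨ν, hν, hle⟩ := exists_isMultivariateGamma_ge hα1 hc h' hAτ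
    rw [← hRτ] at hν
    have := hν.isProbabilityMeasure
    refine ⟨_, hasDerivAt_integral_testFun hd (posSemidef_crossScale hR.posSemidef hτ.1 hτ.2) hν,
      fun hτ' => ?_⟩
    have hnn : ∀ S, 0 ≤ ∫ y, testFun (eulerOn S P) y ∂ν := fun S => by
      refine integral_nonneg_of_ae ?_
      filter_upwards [hν.nonneg] with y hy
      exact testFun_nonneg (eval_eulerOn_nonneg hP hP' S) hy
    have hS : ∀ S : Finset (ι₁ ⊕ ι₂),
        0 ≤ -deriv (fun σ => (crossScale σ (principalPart S R)).det) τ := fun S => by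
      rw [neg_nonneg, hRc]
      exact deriv_det_crossScale_nonpos (posDef_principalPart S hc hA) hτ'
    have hlow : W * I ≤ ∫ y, testFun (eulerOn S₀ P) y ∂ν := by
      have hw : W ≤ (1 + c⁻¹ • crossScale τ A).det ^ (-(α + 1)) := by
        rw [hW, ← hMτ]
        exact Real.rpow_le_rpow_of_nonpos (hMdet τ hτ)
          (antitoneOn_det_crossScale hMpos.posSemidef (posDef_toBlocks₁₁ hMpos)
            (by simp) hτ hτ.1) (by linarith)
      have hI0 : 0 ≤ I := by
        refine Finset.prod_nonneg fun s _ => integral_nonneg_of_ae ?_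
        filter_upwards [gammaMeasure_ae_nonneg (α + 1) c⁻¹] with y hy
        exact eval_eulerOn_nonneg hP hP' S₀ s _ (exp_neg_mem_Icc hy).1 (exp_neg_mem_Icc hy).2
      have h1 := integral_mono_measure hle (f := testFun (eulerOn S₀ P))
        (by
          filter_upwards [hν.nonneg] with y hy
          exact testFun_nonneg (eval_eulerOn_nonneg hP hP' S₀) hy)
        (integrable_testFun _ hν.nonneg)
      rw [integral_smul_measure, ENNReal.toReal_ofReal (hWpos.le.trans hw), smul_eq_mul,
        integral_testFun_gammaProduct hα1 hc'] at h1
      exact (mul_le_mul_of_nonneg_right hw hI0).trans h1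
    have h2 := Finset.single_le_sum (f := fun S : Finset (ι₁ ⊕ ι₂) =>
      -deriv (fun σ => (crossScale σ (principalPart S R)).det) τ *
        ∫ y, testFun (eulerOn S P) y ∂ν) (fun S _ => mul_nonneg (hS S) (hnn S))
        (Finset.mem_univ S₀)
    refine le_trans ?_ (mul_le_mul_of_nonneg_left h2 hα.le)
    rw [hS₀, deriv_det_crossScale_principalPart_pair hdiag hsymm, neg_neg, ← hS₀, ← hr_def]
    have h3 : 0 ≤ α * (2 * τ * r ^ 2) := by have := hτ.1; positivity
    have := mul_le_mul_of_nonneg_left hlow h3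
    linarith
  choose! g' hg' hlow using hderiv
  -- the subtracted multiple of `τ²` has exactly the lower bound of `G'` as its derivative
  have hmono : MonotoneOn (fun τ => G τ - α * r ^ 2 * W * I * τ ^ 2) (Set.Icc 0 1) := by
    have hH : ∀ τ ∈ Set.Icc (0 : ℝ) 1, HasDerivAt (fun τ => G τ - α * r ^ 2 * W * I * τ ^ 2)
        (g' τ - α * r ^ 2 * W * I * (2 * τ)) τ := fun τ hτ => by
      refine ((hg' τ hτ).sub ((hasDerivAt_pow 2 τ).const_mul _)).congr_deriv ?_
      simp
    refine monotoneOn_of_deriv_nonneg (convex_Icc 0 1)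
      (fun τ hτ => (hH τ hτ).continuousAt.continuousWithinAt) (fun τ hτ => ?_) fun τ hτ => ?_
    · exact (hH τ (interior_subset hτ)).differentiableAt.differentiableWithinAt
    · rw [(hH τ (interior_subset hτ)).deriv]
      rw [interior_Icc] at hτ
      have := hlow τ (Set.Ioo_subset_Icc_self hτ) hτ
      linarith
  have := hmono (Set.left_mem_Icc.mpr zero_le_one) (Set.right_mem_Icc.mpr zero_le_one) zero_le_one
  rw [hG1, hG0]
  simp only at this
  linarith

omit [DecidableEq ι] in
lemma tendsto_integral_testFun_step {μ : Measure (ι → ℝ)} [IsProbabilityMeasure μ]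
    (hμ : ∀ᵐ y ∂μ, ∀ i, 0 ≤ y i) {x : ι → ℝ} (hx : ∀ i, 0 < x i) :
    Tendsto (fun N => ∫ y, testFun (fun i => stepPolynomial (Real.exp (-x i)) N) y ∂μ) atTop
      (𝓝 (jointCDF μ x)) := by
  have hmeas : MeasurableSet {y : ι → ℝ | ∀ i, y i ≤ x i} := by
    simp only [Set.ofPred_forall]
    exact MeasurableSet.iInter fun i => measurableSet_le (measurable_pi_apply i) measurable_const
  have hcdf : jointCDF μ x = ∫ y, {y : ι → ℝ | ∀ i, y i ≤ x i}.indicator 1 y ∂μ := by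
    rw [integral_indicator_one hmeas, jointCDF]
  rw [hcdf]
  refine tendsto_integral_of_dominated_convergence (fun _ => 1)
    (fun N => (continuous_testFun _).aestronglyMeasurable) (integrable_const _) (fun N => ?_) ?_
  · filter_upwards [hμ] with y hy
    have h := fun i => eval_stepPolynomial_mem_Icc (Real.exp (-x i)) N
      (exp_neg_mem_Icc (hy i)).1 (exp_neg_mem_Icc (hy i)).2
    rw [testFun, norm_prod]
    exact Finset.prod_le_one (fun _ _ => norm_nonneg _) fun i _ => by
      rw [Real.norm_eq_abs, abs_of_nonneg (h i).1]; exact (h i).2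
  · filter_upwards [hμ] with y hy
    have h := tendsto_finsetProd (Finset.univ : Finset ι) fun i _ =>
      tendsto_eval_stepPolynomial (Real.exp_pos (-x i)) (exp_neg_mem_Icc (hx i).le).2
        (exp_neg_mem_Icc (hy i)).1 (exp_neg_mem_Icc (hy i)).2
    simp only [Real.exp_le_exp, neg_le_neg_iff] at h
    have hval : {y : ι → ℝ | ∀ i, y i ≤ x i}.indicator 1 y =
        ∏ i, if y i ≤ x i then (1 : ℝ) else 0 := by
      by_cases hall : ∀ i, y i ≤ x i
      · rw [Set.indicator_of_mem (show y ∈ {y : ι → ℝ | ∀ i, y i ≤ x i} from hall)]; simp [hall]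
      · rw [Set.indicator_of_notMem (show y ∉ {y : ι → ℝ | ∀ i, y i ≤ x i} from hall)]
        obtain ⟨i, hi⟩ := not_forall.mp hall
        exact (Finset.prod_eq_zero (Finset.mem_univ i) (if_neg hi)).symm
    rw [hval]
    exact h

/-- The product measure of `μ₁` and `μ₂`, transported to functions on `ι₁ ⊕ ι₂`. -/
noncomputable def sumProd (μ₁ : Measure (ι₁ → ℝ)) (μ₂ : Measure (ι₂ → ℝ)) :
    Measure (ι₁ ⊕ ι₂ → ℝ) :=
  (μ₁.prod μ₂).map (MeasurableEquiv.sumPiEquivProdPi fun _ : ι₁ ⊕ ι₂ => ℝ).symm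

lemma isMultivariateGamma_sumProd {α : ℝ} {R : Matrix (ι₁ ⊕ ι₂) (ι₁ ⊕ ι₂) ℝ} (hR : R.PosDef)
    {μ₁ : Measure (ι₁ → ℝ)} {μ₂ : Measure (ι₂ → ℝ)} (h₁ : IsMultivariateGamma α R.toBlocks₁₁ μ₁)
    (h₂ : IsMultivariateGamma α R.toBlocks₂₂ μ₂) :
    IsMultivariateGamma α (crossScale 0 R) (sumProd μ₁ μ₂) := by
  have := h₁.isProbabilityMeasure
  have := h₂.isProbabilityMeasure
  set e := (MeasurableEquiv.sumPiEquivProdPi fun _ : ι₁ ⊕ ι₂ => ℝ).symm with he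
  have hl : ∀ p s, e p (Sum.inl s) = p.1 s := fun _ _ => rfl
  have hr : ∀ p s, e p (Sum.inr s) = p.2 s := fun _ _ => rfl
  refine ⟨Measure.isProbabilityMeasure_map e.measurable.aemeasurable, ?_, fun t ht => ?_⟩
  · rw [sumProd, ← he, ae_map_iff e.measurable.aemeasurable (by measurability)]
    filter_upwards [Measure.quasiMeasurePreserving_fst.ae h₁.nonneg,
      Measure.quasiMeasurePreserving_snd.ae h₂.nonneg] with p hp1 hp2
    rintro (s | s)
    · exact hp1 s
    · exact hp2 s
  · have hdet : (1 + crossScale 0 R * diagonal t).det =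
        (1 + R.toBlocks₁₁ * diagonal fun s => t (Sum.inl s)).det *
          (1 + R.toBlocks₂₂ * diagonal fun s => t (Sum.inr s)).det := by
      have ht' : diagonal t = fromBlocks (diagonal fun s => t (Sum.inl s)) 0 0
          (diagonal fun s => t (Sum.inr s)) := by
        rw [fromBlocks_diagonal]; congr 1; ext (s | s) <;> rfl
      rw [crossScale_eq_fromBlocks, ht', fromBlocks_multiply, ← fromBlocks_one, fromBlocks_add]
      simp
    have hpos₁ := det_one_add_mul_diagonal_pos (posDef_toBlocks₁₁ hR).posSemidef
      (t := fun s => t (Sum.inl s)) fun s => ht _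
    have hpos₂ := det_one_add_mul_diagonal_pos (posDef_toBlocks₂₂ hR).posSemidef
      (t := fun s => t (Sum.inr s)) fun s => ht _
    rw [sumProd, ← he, integral_map_equiv, hdet, Real.mul_rpow hpos₁.le hpos₂.le,
      ← h₁.laplace _ fun s => ht _, ← h₂.laplace _ fun s => ht _, ← integral_prod_mul]
    refine integral_congr_ae (Eventually.of_forall fun p => ?_)
    simp only [Fintype.sum_sum_type, hl, hr, neg_add, Real.exp_add]

omit [Fintype ι₁] [DecidableEq ι₁] [DecidableEq ι₂] in
lemma jointCDF_sumProd (μ₁ : Measure (ι₁ → ℝ)) (μ₂ : Measure (ι₂ → ℝ)) [IsFiniteMeasure μ₁]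
    [IsFiniteMeasure μ₂] (x : ι₁ ⊕ ι₂ → ℝ) :
    jointCDF (sumProd μ₁ μ₂) x =
      jointCDF μ₁ (fun i => x (Sum.inl i)) * jointCDF μ₂ (fun j => x (Sum.inr j)) := by
  rw [jointCDF, jointCDF, jointCDF, ← measureReal_prod_prod, measureReal_def, measureReal_def,
    sumProd, MeasurableEquiv.map_apply]
  congr 2
  ext p
  exact ⟨fun h => ⟨fun i => h (Sum.inl i), fun j => h (Sum.inr j)⟩,
    fun h => by rintro (i | j); exacts [h.1 i, h.2 j]⟩

/-- The strict product inequality for the distribution functions of `Γ(α, R)`. -/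
theorem jointCDF_mul_lt {α : ℝ} (hα : 0 < α)
    {R : Matrix (ι₁ ⊕ ι₂) (ι₁ ⊕ ι₂) ℝ} (hR : R.PosDef) (hdiag : ∀ i, R i i = 1)
    (h : (∃ k : ℕ, 2 * α = k) ∨ (Fintype.card (ι₁ ⊕ ι₂) : ℝ) - 2 < 2 * α)
    {i : ι₁} {j : ι₂} (hij : R (Sum.inl i) (Sum.inr j) ≠ 0)
    {μ : Measure (ι₁ ⊕ ι₂ → ℝ)} {μ₁ : Measure (ι₁ → ℝ)} {μ₂ : Measure (ι₂ → ℝ)}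
    (hμ : IsMultivariateGamma α R μ) (h₁ : IsMultivariateGamma α R.toBlocks₁₁ μ₁)
    (h₂ : IsMultivariateGamma α R.toBlocks₂₂ μ₂) {x : ι₁ ⊕ ι₂ → ℝ} (hx : ∀ s, 0 < x s) :
    jointCDF μ₁ (fun i => x (Sum.inl i)) * jointCDF μ₂ (fun j => x (Sum.inr j)) <
      jointCDF μ x := by
  have := hμ.isProbabilityMeasure
  have := h₁.isProbabilityMeasure
  have := h₂.isProbabilityMeasure
  have h₀ := isMultivariateGamma_sumProd hR h₁ h₂
  have := h₀.isProbabilityMeasure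
  rw [← jointCDF_sumProd]
  obtain ⟨C, hC, r, hr, hle⟩ := exists_le_integral_testFun_sub hα hR hdiag h hij
  choose δ hδ hev using fun s =>
    eventually_le_integral_stepPolynomial (by linarith : 0 < α + 1) hr (hx s)
  have hpos : 0 < C * ∏ s, δ s := mul_pos hC (Finset.prod_pos fun s _ => hδ s)
  have hlim := (tendsto_integral_testFun_step hμ.nonneg hx).sub
    (tendsto_integral_testFun_step h₀.nonneg hx)
  have hbound : C * ∏ s, δ s ≤ jointCDF μ x - jointCDF (sumProd μ₁ μ₂) x := by
    refine ge_of_tendsto hlim ?_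
    filter_upwards [eventually_all.mpr hev] with N hN
    refine le_trans ?_ (hle _ (fun s u h0 h1 => (eval_stepPolynomial_mem_Icc _ N h0 h1).1)
      (fun s u h0 h1 => eval_derivative_stepPolynomial_nonneg _ N h0 h1) μ _ hμ h₀)
    refine mul_le_mul_of_nonneg_left
      (Finset.prod_le_prod (fun s _ => (hδ s).le) fun s _ => ?_) hC.le
    unfold eulerOn
    split_ifs
    · exact (hN s).2
    · exact (hN s).1
  linarith

end MultivariateGamma


theorem theorem1 (n₁ n₂ : ℕ) (R : Matrix (Fin n₁ ⊕ Fin n₂) (Fin n₁ ⊕ Fin n₂) ℝ)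
    (hR : IsCorrelationMatrix R) (hdet : R.det ≠ 0) (hrank : 0 < R.toBlocks₁₂.rank)
    (α : ℝ)
    (hα : (∃ k : ℕ, 0 < k ∧ 2 * α = (k : ℝ)) ∨ ((n₁ + n₂ : ℕ) : ℝ) - 2 < 2 * α) :
    -- the three laws exist and are determined by their Laplace transforms
    (∃! μ : Measure (Fin n₁ ⊕ Fin n₂ → ℝ), IsMultivariateGamma α R μ) ∧
    (∃! μ₁ : Measure (Fin n₁ → ℝ), IsMultivariateGamma α R.toBlocks₁₁ μ₁) ∧
    (∃! μ₂ : Measure (Fin n₂ → ℝ), IsMultivariateGamma α R.toBlocks₂₂ μ₂) ∧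
    -- and their distribution functions satisfy the strict product inequality
    ∀ (μ : Measure (Fin n₁ ⊕ Fin n₂ → ℝ)) (μ₁ : Measure (Fin n₁ → ℝ))
      (μ₂ : Measure (Fin n₂ → ℝ)),
      IsMultivariateGamma α R μ → IsMultivariateGamma α R.toBlocks₁₁ μ₁ →
      IsMultivariateGamma α R.toBlocks₂₂ μ₂ →
      ∀ x : Fin n₁ ⊕ Fin n₂ → ℝ, (∀ i, 0 < x i) →
        jointCDF μ₁ (fun i => x (Sum.inl i)) * jointCDF μ₂ (fun j => x (Sum.inr j))
          < jointCDF μ x := by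
  open MultivariateGamma in
  have hpd : R.PosDef := hR.posSemidef.posDef_iff_det_ne_zero.mpr hdet
  obtain ⟨i, j, hij⟩ : ∃ i j, R (Sum.inl i) (Sum.inr j) ≠ 0 := by
    by_contra! h0
    have : R.toBlocks₁₂ = 0 := by ext i j; exact h0 i j
    simp [this] at hrank
  have hn₁ : 1 ≤ n₁ := i.pos
  have hn₂ : 1 ≤ n₂ := j.pos
  have hn₁' : (1 : ℝ) ≤ n₁ := by exact_mod_cast hn₁
  have hn₂' : (1 : ℝ) ≤ n₂ := by exact_mod_cast hn₂
  push_cast at hα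
  have hα0 : 0 < α := by
    rcases hα with ⟨k, hk, hk'⟩ | h
    · have : (0 : ℝ) < k := by exact_mod_cast hk
      linarith
    · linarith
  have hα' : ∀ m : ℝ, m ≤ n₁ + n₂ → (∃ k : ℕ, 2 * α = k) ∨ m - 2 < 2 * α := fun m hm =>
    hα.imp (fun ⟨k, _, hk⟩ => ⟨k, hk⟩) fun h => by linarith
  have hne₁ : Nonempty (Fin n₁) := ⟨i⟩
  have hne₂ : Nonempty (Fin n₂) := ⟨j⟩
  have hex : ∀ {ι : Type} [Fintype ι] [DecidableEq ι] [Nonempty ι] {Q : Matrix ι ι ℝ},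
      Q.PosDef → (Fintype.card ι : ℝ) ≤ n₁ + n₂ → ∃! μ, IsMultivariateGamma α Q μ := by
    intro ι _ _ _ Q hQ hcard
    obtain ⟨μ, hμ⟩ := exists_isMultivariateGamma hQ hα0 (hα' _ hcard)
    exact ⟨μ, hμ, fun ν hν => isMultivariateGamma_unique hν hμ⟩
  refine ⟨hex hpd (by simp), hex (posDef_toBlocks₁₁ hpd) (by simp),
    hex (posDef_toBlocks₂₂ hpd) (by simp), ?_⟩
  intro μ μ₁ μ₂ hμ h₁ h₂ x hx
  exact jointCDF_mul_lt hα0 hpd hR.diag_eq_one (hα' _ (by simp)) hij hμ h₁ h₂ hx
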